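/- Let $T_4$ be the rooted tree of finite words over a four-letter alphabet, let $\mathrm{Aut}\,T_4$ carry the congruence topology given by the pointwise level stabilizers $\mathrm{St}(n)$, and let $W_4\le \mathrm{Aut}\,T_4$ be the group of all automorphisms whose local action on the immediate descendants of every vertex lies in $\langle(1\,2\,3\,4)\rangle$. For $\mathbf e=(e_1,e_2,e_3)\in(\mathbb Z/4\mathbb Z)^3$ let $G=\langle a,b\rangle\le W_4$ be the GGS-group with defining vector $\mathbf e$: here $a$ permutes the four first-level subtrees rigidly by the cycle $(1\,2\,3\,4)$, and $b$ fixes the first level and acts on the four first-level subtrees as $(a^{e_1},a^{e_2},a^{e_3},b)$. For $H\le \mathrm{Aut}\,T_4$ write $\mathrm{St}_H(n)=H\cap\mathrm{St}(n)$ and $H_n=H/\mathrm{St}_H(n)$, and for a closed subgroup $H\le W_4$ let $$\mathrm{hdim}_{W_4}(H)=\liminf_{n\to\infty}\frac{\log|H:\mathrm{St}_H(n)|}{\log|W_4:\mathrm{St}_{W_4}(n)|}$$ be its Hausdorff dimension in $W_4$. Logarithms are in base $4$. Suppose that $\mathbf e$ is not invertible-symmetric, i.e. it is not the case that, for all $i\in\{1,2,3\}$,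 $e_i$ is a unit modulo $4$ if and only if $e_{4-i}$ is a unit modulo $4$. Then, with $\overline G$ the closure of $G$: - if $e_1+e_2+e_3$ is odd, then $\mathrm{hdim}_{W_4}(\overline G)=3/4$, $\log|G_n|=4^{n-1}+1$ for all $n\ge 2$, and $\log|G_1|=1$; - if $e_1+e_2+e_3$ is even, then $\mathrm{hdim}_{W_4}(\overline G)=9/16$ and $\log|G_n|=3\cdot 4^{n-2}+1$ for all $n\ge 2$. -/

import Mathlib

open Filter

noncomputable section

/-- The `m`-adic tree: vertices are the finite words over `Fin m`, the root is the empty word, and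
the immediate descendants of `v` are the words `v ++ [x]`. -/
def adicTree (m : ℕ) : SimpleGraph (List (Fin m)) where
  Adj u v := (∃ x, v = u ++ [x]) ∨ (∃ x, u = v ++ [x])
  symm := ⟨fun _ _ h => h.symm⟩
  loopless := ⟨by
    rintro u (⟨x, h⟩ | ⟨x, h⟩) <;> simpa using congrArg List.length h⟩

/-- The automorphisms of the rooted `m`-adic tree. (For `m ≥ 2` every graph automorphism
fixes the root, as the root is the only vertex of degree `m`.) -/
def rootedAut (m : ℕ) : Subgroup (adicTree m ≃g adicTree m) where
  carrier := {f | f [] = []}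
  one_mem' := rfl
  mul_mem' {f g} hf hg := by
    change f (g []) = []
    rw [show g [] = [] from hg]; exact hf
  inv_mem' {f} hf := by
    change f.symm [] = []
    have h : f [] = [] := hf
    rw [RelIso.symm_apply_eq, h]

/-- The group `Aut T_m` of automorphisms of the `m`-adic tree. -/
abbrev AutT (m : ℕ) : Type := rootedAut m

namespace AutT

variable {m : ℕ}

instance : CoeFun (AutT m) (fun _ => List (Fin m) → List (Fin m)) := ⟨fun f => f.1⟩

@[simp] theorem one_apply (v : List (Fin m)) : (1 : AutT m) v = v := rfl

@[simp] theorem mul_apply (f g : AutT m) (v : List (Fin m)) : (f * g) v = f (g v) := rfl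

@[simp] theorem inv_apply_self (f : AutT m) (v : List (Fin m)) : f⁻¹ (f v) = v :=
  f.1.symm_apply_apply v

@[simp] theorem apply_inv_self (f : AutT m) (v : List (Fin m)) : f (f⁻¹ v) = v :=
  f.1.apply_symm_apply v

@[simp] theorem apply_nil (f : AutT m) : f [] = [] := f.2

@[ext] theorem ext {f g : AutT m} (h : ∀ v, f v = g v) : f = g :=
  Subtype.ext (RelIso.ext h)

/-- Automorphisms map the immediate descendants of `u` to those of its image. -/
theorem exists_apply_append (f : AutT m) (u : List (Fin m)) (x : Fin m) :
    ∃ y, f (u ++ [x]) = f u ++ [y] := by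
  induction u using List.reverseRecOn generalizing x with
  | nil =>
    have h : (adicTree m).Adj (f []) (f ([] ++ [x])) :=
      f.1.map_rel_iff.2 (Or.inl ⟨x, rfl⟩)
    rcases h with ⟨y, h⟩ | ⟨y, h⟩
    · exact ⟨y, h⟩
    · simp at h
  | append_singleton w z ih =>
    have h : (adicTree m).Adj (f (w ++ [z])) (f (w ++ [z] ++ [x])) :=
      f.1.map_rel_iff.2 (Or.inl ⟨x, rfl⟩)
    rcases h with ⟨y, h⟩ | ⟨y, h⟩
    · exact ⟨y, h⟩
    · exfalso
      obtain ⟨z', hz⟩ := ih z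
      have h2 : f w ++ [z'] = f (w ++ [z] ++ [x]) ++ [y] := hz.symm.trans h
      have h3 : f w = f (w ++ [z] ++ [x]) := (List.append_inj' h2 rfl).1
      have h4 := congrArg List.length (f.1.injective h3)
      simp at h4

@[simp] theorem length_apply (f : AutT m) (v : List (Fin m)) : (f v).length = v.length := by
  induction v using List.reverseRecOn with
  | nil => simp
  | append_singleton w z ih =>
    obtain ⟨y, hy⟩ := exists_apply_append f w z
    rw [hy]; simp [ih]

/-- A bijection of the words which fixes the root and which, like its inverse, maps immediate
descendants to immediate descendants, as an automorphism of the tree. -/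
def mk' (f : Equiv.Perm (List (Fin m))) (h0 : f [] = [])
    (h1 : ∀ u x, ∃ y, f (u ++ [x]) = f u ++ [y])
    (h2 : ∀ u x, ∃ y, f.symm (u ++ [x]) = f.symm u ++ [y]) : AutT m :=
  ⟨{ f with
      map_rel_iff' := by
        have key : ∀ g : Equiv.Perm (List (Fin m)), (∀ u x, ∃ y, g (u ++ [x]) = g u ++ [y]) →
            ∀ u v, (adicTree m).Adj u v → (adicTree m).Adj (g u) (g v) := by
          rintro g hg u v (⟨x, rfl⟩ | ⟨x, rfl⟩)
          · exact Or.inl (hg u x)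
          · exact Or.inr (hg v x)
        intro u v
        refine ⟨fun h => ?_, key f h1 u v⟩
        simpa using key f.symm h2 _ _ h }, h0⟩

/-- The `n`th level stabilizer `St(n)`. -/
def St (m n : ℕ) : Subgroup (AutT m) where
  carrier := {f | ∀ v : List (Fin m), v.length = n → f v = v}
  one_mem' := fun _ _ => rfl
  mul_mem' {f g} hf hg v hv := by rw [mul_apply, hg v hv, hf v hv]
  inv_mem' {f} hf v hv := by
    conv_lhs => rw [← hf v hv]
    simp

theorem mem_St {n : ℕ} {f : AutT m} : f ∈ St m n ↔ ∀ v : List (Fin m), v.length = n → f v = v :=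
  Iff.rfl

instance (n : ℕ) : (St m n).Normal where
  conj_mem f hf g v hv := by
    have h : f (g⁻¹ v) = g⁻¹ v := hf _ ((length_apply g⁻¹ v).trans hv)
    change g (f (g⁻¹ v)) = v
    rw [h, apply_inv_self]

theorem St_succ_le (n : ℕ) : St m (n + 1) ≤ St m n := by
  intro f hf v hv
  rcases isEmpty_or_nonempty (Fin m) with hm | ⟨⟨x⟩⟩
  · cases v with
    | nil => simp
    | cons x _ => exact hm.elim x
  · obtain ⟨y, hy⟩ := exists_apply_append f v x
    have h := hf (v ++ [x]) (by simp [hv])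
    exact (List.append_inj' (hy.symm.trans h) rfl).1

theorem St_antitone : Antitone (St m) := antitone_nat_of_succ_le St_succ_le

/-- The level stabilizers as a basis of neighbourhoods of the identity. -/
def congruenceBasis (m : ℕ) : GroupFilterBasis (AutT m) where
  sets := {U | ∃ n, U = (St m n : Set (AutT m))}
  nonempty := ⟨_, 0, rfl⟩
  inter_sets := by
    rintro _ _ ⟨k, rfl⟩ ⟨l, rfl⟩
    exact ⟨_, ⟨max k l, rfl⟩, Set.subset_inter (St_antitone (le_max_left k l))
      (St_antitone (le_max_right k l))⟩
  one' := by rintro _ ⟨n, rfl⟩; exact (St m n).one_mem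
  mul' := by
    rintro _ ⟨n, rfl⟩
    refine ⟨_, ⟨n, rfl⟩, ?_⟩
    rintro _ ⟨f, hf, g, hg, rfl⟩
    exact (St m n).mul_mem hf hg
  inv' := by
    rintro _ ⟨n, rfl⟩
    exact ⟨_, ⟨n, rfl⟩, fun f hf => (St m n).inv_mem hf⟩
  conj' := by
    rintro g _ ⟨n, rfl⟩
    exact ⟨_, ⟨n, rfl⟩, fun f hf => (inferInstance : (St m n).Normal).conj_mem f hf g⟩

/-- The congruence topology. -/
instance (m : ℕ) : TopologicalSpace (AutT m) := (congruenceBasis m).topology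

instance (m : ℕ) : IsTopologicalGroup (AutT m) := (congruenceBasis m).isTopologicalGroup

/-- The congruence quotient `G_n = G / St_G(n)`. -/
abbrev CongruenceQuotient (G : Subgroup (AutT m)) (n : ℕ) : Type :=
  G ⧸ (St m n).subgroupOf G

/-- The logarithmic order `log |G_n|`, the logarithm being taken in base `m`. -/
def logOrder (G : Subgroup (AutT m)) (n : ℕ) : ℝ :=
  Real.logb m (Nat.card (CongruenceQuotient G n))

/-- The Hausdorff dimension `hdim_W(G)` of `G` in `W`, for closed subgroups `G ≤ W` of `Aut T_m`:
the lower limit of `log |G : St_G(n)| / log |W : St_W(n)|`. As `G ≤ W`, these quotients lie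
in `[0, 1]`, so that the lower limit in `ℝ` is the usual one. -/
def hdim (W G : Subgroup (AutT m)) : ℝ :=
  liminf (fun n => logOrder G n / logOrder W n) atTop

/-- The iterated wreath product `W_H`: the automorphisms whose local action on the immediate
descendants of every vertex is given by a permutation in `H`. -/
def iteratedWreath (H : Subgroup (Equiv.Perm (Fin m))) : Subgroup (AutT m) where
  carrier := {f | ∀ v : List (Fin m), ∃ σ ∈ H, ∀ x, f (v ++ [x]) = f v ++ [σ x]}
  one_mem' v := ⟨1, H.one_mem, fun _ => rfl⟩
  mul_mem' {f g} hf hg v := by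
    obtain ⟨τ, hτ, h1⟩ := hg v
    obtain ⟨σ, hσ, h2⟩ := hf (g v)
    exact ⟨σ * τ, H.mul_mem hσ hτ, fun x => by simp [h1, h2]⟩
  inv_mem' {f} hf v := by
    obtain ⟨σ, hσ, h⟩ := hf (f⁻¹ v)
    refine ⟨σ⁻¹, H.inv_mem hσ, fun x => f.1.injective ?_⟩
    change f (f⁻¹ (v ++ [x])) = f (f⁻¹ v ++ [σ⁻¹ x])
    rw [h]; simp

/-- The action on words of the rooted automorphism with label `σ`: it permutes the first letter. -/
def rootedFun (σ : Equiv.Perm (Fin m)) : List (Fin m) → List (Fin m)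
  | [] => []
  | x :: w => σ x :: w

theorem rootedFun_append (σ : Equiv.Perm (Fin m)) (u : List (Fin m)) (x : Fin m) :
    ∃ y, rootedFun σ (u ++ [x]) = rootedFun σ u ++ [y] := by
  cases u with
  | nil => exact ⟨σ x, rfl⟩
  | cons z w => exact ⟨x, rfl⟩

/-- The rooted automorphism `ψ(f) = (1, …, 1)σ`. -/
def rooted (σ : Equiv.Perm (Fin m)) : AutT m :=
  mk' ⟨rootedFun σ, rootedFun σ⁻¹,
    fun v => by cases v <;> simp [rootedFun], fun v => by cases v <;> simp [rootedFun]⟩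
    rfl (rootedFun_append σ) (rootedFun_append σ⁻¹)

/-- The action on words of the directed automorphism whose section at the first-level vertex `k` is
the automorphism itself and whose section at any other first-level vertex `x` is `c x`. -/
def directedFun (k : Fin m) (c : Fin m → AutT m) : List (Fin m) → List (Fin m)
  | [] => []
  | x :: w => x :: if x = k then directedFun k c w else c x w

theorem directedFun_append (k : Fin m) (c : Fin m → AutT m) (u : List (Fin m)) (x : Fin m) :
    ∃ y, directedFun k c (u ++ [x]) = directedFun k c u ++ [y] := by
  induction u with
  | nil => exact ⟨x, by by_cases h : x = k <;> simp [directedFun, h]⟩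
  | cons z w ih =>
    by_cases h : z = k
    · simpa [directedFun, h] using ih
    · simpa [directedFun, h] using exists_apply_append (c z) w x

theorem directedFun_directedFun (k : Fin m) (c d : Fin m → AutT m) (h : ∀ x, c x * d x = 1)
    (v : List (Fin m)) : directedFun k c (directedFun k d v) = v := by
  induction v with
  | nil => rfl
  | cons z w ih =>
    by_cases hz : z = k
    · simpa [directedFun, hz] using ih
    · simp [directedFun, hz, ← mul_apply, h]

/-- The directed automorphism with trivial action on the first level, with section itself at `k`
and section `c x` at every `x ≠ k`. -/
def directed (k : Fin m) (c : Fin m → AutT m) : AutT m :=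
  mk' ⟨directedFun k c, directedFun k c⁻¹,
    directedFun_directedFun k c⁻¹ c (by simp), directedFun_directedFun k c c⁻¹ (by simp)⟩
    rfl (directedFun_append k c) (directedFun_append k c⁻¹)

end AutT

namespace GGS

open AutT

/-- The `4`-cycle `(1 2 3 4)`, the letters being written `0, 1, 2, 3`. -/
def cycle : Equiv.Perm (Fin 4) := finRotate 4

/-- The rooted automorphism `ψ(a) = (1, 1, 1, 1)(1 2 3 4)`. -/
def a : AutT 4 := rooted cycle

/-- The directed automorphism `ψ(b) = (a ^ e₁, a ^ e₂, a ^ e₃, b)`, where `e₁, e₂, e₃` are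
`e 0, e 1, e 2`. (The last entry of the list of sections is not used by `directed`.) -/
def b (e : Fin 3 → ZMod 4) : AutT 4 :=
  directed 3 ![a ^ (e 0).val, a ^ (e 1).val, a ^ (e 2).val, 1]

/-- The GGS-group with defining vector `e`. -/
def group (e : Fin 3 → ZMod 4) : Subgroup (AutT 4) := Subgroup.closure {a, b e}

/-- `e` is invertible-symmetric: `eᵢ` is a unit if and only if `e₄₋ᵢ` is, for `i = 1, 2, 3`. -/
def IsInvertibleSymmetric (e : Fin 3 → ZMod 4) : Prop :=
  ∀ i : Fin 3, IsUnit (e i) ↔ IsUnit (e i.rev)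

/-- The group `W_4`, for `H` generated by the cycle `(1 2 3 4)`. -/
def W4 : Subgroup (AutT 4) := iteratedWreath (Subgroup.zpowers cycle)

end GGS

end

open scoped commutatorElement

noncomputable section

/-! ### Subdirect subgroups of direct powers and the lower central series -/

namespace Subgroup

variable {ι G : Type*} [Group G]

/-! Let `N ≤ G⁴` be the group of section families of the elements of St_G(1). Since `G` acts on the
first level as a cyclic group of order 4, |G_{n+1}| = 4·|N : N ∩ St_G(n)⁴|, so everything depends on
how large `N` is modulo St_G(n)⁴.

One constraint on `N` is visible in the abelianization, which is (ℤ/4)² with coordinates the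
exponents of `a` and `b`: the `a`-exponents of the sections are the image of their `b`-exponents
under a circulant matrix built from `e` (`exponentGraph_decomposition`). The exponents are well
defined because non-symmetry already makes them trivial on St_G(2)
(`exponents_eq_one_of_mem_St_two`).

For n ≥ 2 this is the only constraint modulo St_G(n)⁴, so N·St_G(n)⁴ has index 4⁴
(`index_sectionGroup_sup`). What must be shown is that it contains (G')⁴. Commutators of
neighbouring conjugates of `b` give, modulo γ₃(G)⁴, a matrix "unit plus even" by non-symmetry; it is
invertible modulo 4, so `N` covers (G')⁴ modulo γ₃(G)⁴ (`pi_lowerCentralSeries_one_le`). As `N` is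
subdirect, this propagates down the lower central series, which eventually enters St_G(n) because
`G_n` is a finite 2-group.

Hence 4³·|G_{n+1}| = |G_n|⁴ for n ≥ 2, with |G_2| equal to 4 times the order of the image of the
circulant: 4⁴ for odd sum, 4³ for even sum. -/

theorem eq_comap_top_of_map_evalMonoidHom {N : Subgroup (ι → G)} {i : ι}
    (h : N.map (Pi.evalMonoidHom (fun _ => G) i) = ⊤) (g : G) : ∃ n ∈ N, n i = g := by
  have : g ∈ N.map (Pi.evalMonoidHom (fun _ => G) i) := h ▸ mem_top g
  exact this

instance normal_pi_univ (H : ι → Subgroup G) [∀ i, (H i).Normal] : (pi Set.univ H).Normal where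
  conj_mem n hn g i hi := Normal.conj_mem inferInstance (n i) (hn i hi) (g i)

variable [Finite ι] [DecidableEq ι]

/-- If a subdirect subgroup of a power of `G` contains a direct power of a term of the lower central
series modulo the next term, then the same holds for the next term. -/
theorem pi_lowerCentralSeries_succ_le_sup {N : Subgroup (ι → G)}
    (hN : ∀ i, N.map (Pi.evalMonoidHom (fun _ => G) i) = ⊤) {k : ℕ}
    (hk : pi Set.univ (fun _ : ι => (⊤ : Subgroup G).lowerCentralSeries k) ≤
      N ⊔ pi Set.univ (fun _ => (⊤ : Subgroup G).lowerCentralSeries (k + 1))) :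
    pi Set.univ (fun _ : ι => (⊤ : Subgroup G).lowerCentralSeries (k + 1)) ≤
      N ⊔ pi Set.univ (fun _ => (⊤ : Subgroup G).lowerCentralSeries (k + 2)) := by
  rw [pi_le_iff]
  intro i
  rw [map_le_iff_le_comap]
  refine commutator_le.2 fun g hg h _ => ?_
  -- Subdirectness replaces `h` by a full family `m ∈ N`: a commutator with an element supported at
  -- `i` only sees the coordinate `m i`.
  obtain ⟨m, hm, rfl⟩ := eq_comap_top_of_map_evalMonoidHom (hN i) h
  have hg' := hk ((mulSingle_mem_pi (f := fun _ => G) i g).2 fun _ => hg)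
  obtain ⟨n, hn, z, hz, hnz⟩ := mem_sup_of_normal_right.1 hg'
  have h1 : (MonoidHom.mulSingle (fun _ => G) i) ⁅g, m i⁆ = ⁅(Pi.mulSingle i g : ι → G), m⁆ := by
    funext j
    by_cases hj : j = i
    · subst hj; simp [commutatorElement_def]
    · simp [commutatorElement_def, hj]
  rw [mem_comap, h1, ← hnz, commutatorElement_mul_left_eq_conj_mul]
  refine mul_mem (mem_sup_right (Normal.conj_mem inferInstance _ ?_ _)) (mem_sup_left ?_)
  · exact fun j _ => commutator_mem_commutator (hz j trivial) (mem_top _)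
  · rw [commutatorElement_def]
    exact mul_mem (mul_mem (mul_mem hn hm) (inv_mem hn)) (inv_mem hm)

/-- The layers of the lower central series are absorbed into `N` one after another, so information
modulo γ₃ (index 2 here, the series starting at 0) suffices for every depth. -/
theorem pi_lowerCentralSeries_one_le_sup {N : Subgroup (ι → G)}
    (hN : ∀ i, N.map (Pi.evalMonoidHom (fun _ => G) i) = ⊤)
    (h : pi Set.univ (fun _ : ι => (⊤ : Subgroup G).lowerCentralSeries 1) ≤
      N ⊔ pi Set.univ (fun _ => (⊤ : Subgroup G).lowerCentralSeries 2)) (k : ℕ) :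
    pi Set.univ (fun _ : ι => (⊤ : Subgroup G).lowerCentralSeries 1) ≤
      N ⊔ pi Set.univ (fun _ => (⊤ : Subgroup G).lowerCentralSeries (k + 1)) := by
  have step (k : ℕ) : pi Set.univ (fun _ : ι => (⊤ : Subgroup G).lowerCentralSeries (k + 1)) ≤
      N ⊔ pi Set.univ (fun _ => (⊤ : Subgroup G).lowerCentralSeries (k + 2)) := by
    induction k with
    | zero => exact h
    | succ k ih => exact pi_lowerCentralSeries_succ_le_sup hN ih
  induction k with
  | zero => exact le_sup_right
  | succ k ih => exact ih.trans (sup_le le_sup_left (step k))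

/-- In a group generated by `a` and `b`, a normal subgroup containing the commutator of `a` and `b`
contains the commutator subgroup. -/
theorem lowerCentralSeries_one_le_of_commutatorElement_mem {H : Subgroup G} [H.Normal] {a b : G}
    (hab : closure {a, b} = ⊤) (h : ⁅a, b⁆ ∈ H) : (⊤ : Subgroup G).lowerCentralSeries 1 ≤ H := by
  have h1 : closure {(a : G ⧸ H), (b : G ⧸ H)} = ⊤ := by
    have := congrArg (map (QuotientGroup.mk' H)) hab
    rwa [MonoidHom.map_closure, Set.image_pair,
      map_top_of_surjective _ (QuotientGroup.mk'_surjective H)] at this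
  have hc : (a : G ⧸ H) * b = b * a := by
    rw [← commutatorElement_eq_one_iff_mul_comm]
    exact (QuotientGroup.eq_one_iff (⁅a, b⁆)).2 h
  have h2 : closure {(a : G ⧸ H), (b : G ⧸ H)} ≤
      centralizer (closure {(a : G ⧸ H), (b : G ⧸ H)} : Set (G ⧸ H)) := by
    rw [le_centralizer_iff_isMulCommutative]
    refine isMulCommutative_closure ?_
    rintro x (rfl | rfl) y (rfl | rfl)
    exacts [rfl, hc, hc.symm, rfl]
  refine commutator_le.2 fun x _ y _ => ?_
  rw [← QuotientGroup.eq_one_iff]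
  change ⁅(x : G ⧸ H), (y : G ⧸ H)⁆ = 1
  refine commutatorElement_eq_one_iff_mul_comm.2 ?_
  exact mem_centralizer_iff.1 (h2 (h1 ▸ mem_top (y : G ⧸ H))) _ (h1 ▸ mem_top (x : G ⧸ H))

/-- The conjugate of a⁻¹ by `b` is a⁻¹⁅a, b⁆, a product of commuting factors, so its powers split.
-/
theorem commutatorElement_zpow_left {a b : G} (h : Commute a ⁅a, b⁆) (n : ℤ) :
    ⁅a ^ n, b⁆ = ⁅a, b⁆ ^ n := by
  have h1 : b * a⁻¹ * b⁻¹ = a⁻¹ * ⁅a, b⁆ := by simp [commutatorElement_def, mul_assoc]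
  calc ⁅a ^ n, b⁆ = a ^ n * (b * a⁻¹ * b⁻¹) ^ n := by
        rw [conj_zpow, commutatorElement_def, inv_zpow]; group
    _ = _ := by rw [h1, h.inv_left.mul_zpow]; group

/-- Modulo 4 the operator p + qs is inverted by p − qs, since (p + qs)(p − qs) = p² − q²s² with p² ≡
1 and q² ≡ 0. -/
theorem mem_of_odd_smul_add_even_smul_mem {κ A : Type*} [AddCommGroup A] {T : AddSubgroup A}
    {u : κ → A} {s : κ → κ} {p q : ℤ} (hp : Odd p) (hq : Even q) (h4 : ∀ i, (4 : ℤ) • u i ∈ T)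
    (h : ∀ i, p • u i + q • u (s i) ∈ T) (i : κ) : u i ∈ T := by
  obtain ⟨p, rfl⟩ := hp
  obtain ⟨q, rfl⟩ := hq
  have : u i = (2 * p + 1) • ((2 * p + 1) • u i + (q + q) • u (s i)) - (p ^ 2 + p) • (4 : ℤ) • u i
      - (2 * q) • ((2 * p + 1) • u (s i) + (q + q) • u (s (s i)))
      + (q ^ 2) • (4 : ℤ) • u (s (s i)) := by module
  rw [this]
  exact add_mem (sub_mem (sub_mem (zsmul_mem (h _) _) (zsmul_mem (h4 _) _)) (zsmul_mem (h _) _))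
    (zsmul_mem (h4 _) _)

end Subgroup

/-! ### Commutators of translates of the sections of `b` -/

section

variable {G : Type*} [Group G] {a b : G}

/-- The homomorphism `v ↦ (c ^ v x)ₓ`. -/
def piZPow {ι : Type*} (c : G) : Multiplicative (ι → ℤ) →* (ι → G) where
  toFun v x := c ^ (v.toAdd x)
  map_one' := by ext; simp
  map_mul' v w := by ext; simp [zpow_add]

open Subgroup

variable {p : ZMod 4 → ℤ} {f : ZMod 4 → G} {N : Subgroup (ZMod 4 → G)}

/-- Suitable translates place `b` and an odd power of `a` at any given coordinate; the odd power
generates ⟨a⟩ because odd squares are 1 modulo 4. -/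
theorem map_evalMonoidHom_eq_top (hab : closure {a, b} = ⊤) (ha : a ^ 4 = 1) (hb : f 3 = b)
    (hf : ∀ x ≠ 3, f x = a ^ p x) (hN : ∀ i, (fun x => f (x - i)) ∈ N)
    (hp : Odd (p 0) ∨ Odd (p 2)) (i : ZMod 4) :
    N.map (Pi.evalMonoidHom (fun _ => G) i) = ⊤ := by
  have hmem (j : ZMod 4) : f j ∈ N.map (Pi.evalMonoidHom (fun _ => G) i) :=
    ⟨_, hN (i - j), by simp⟩
  have hodd (j : ZMod 4) (hj : j ≠ 3) (ho : Odd (p j)) :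
      a ∈ N.map (Pi.evalMonoidHom (fun _ => G) i) := by
    have h1 := zpow_mem (hmem j) (p j)
    obtain ⟨r, hr⟩ := ho
    have ha' : a ^ (4 : ℤ) = 1 := by exact_mod_cast ha
    rw [hf j hj, ← zpow_mul, show p j * p j = 1 + 4 * (r ^ 2 + r) by rw [hr]; ring,
      zpow_add, zpow_mul, ha', one_zpow, mul_one, zpow_one] at h1
    exact h1
  rw [eq_top_iff, ← hab, closure_le]
  rintro x (rfl | rfl)
  · exact hp.elim (hodd 0 (by decide)) (hodd 2 (by decide))
  · exact hb ▸ hmem 3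

/-- Modulo γ₃ the commutator `c` of the generators is central with c⁴ = 1, so families of powers of
`c` are vectors modulo 4, and the question becomes whether those realised in `M` include the unit
vectors. -/
theorem pi_lowerCentralSeries_one_le (hab : closure {a, b} = ⊤) (ha : a ^ 4 = 1) (hb : f 3 = b)
    (hf : ∀ x ≠ 3, f x = a ^ p x) (hN : ∀ i, (fun x => f (x - i)) ∈ N)
    (hp : Odd (p 0) ∧ Even (p 2) ∨ Even (p 0) ∧ Odd (p 2)) :
    pi Set.univ (fun _ : ZMod 4 => (⊤ : Subgroup G).lowerCentralSeries 1) ≤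
      N ⊔ pi Set.univ (fun _ => (⊤ : Subgroup G).lowerCentralSeries 2) := by
  set Z := (⊤ : Subgroup G).lowerCentralSeries 2 with hZ
  set M := N ⊔ pi Set.univ (fun _ : ZMod 4 => Z) with hM
  set c := ⁅a, b⁆ with hc
  have hsub := map_evalMonoidHom_eq_top hab ha hb hf hN (hp.imp And.left And.right)
  have hcomm : Commute (a : G ⧸ Z) ⁅(a : G ⧸ Z), (b : G ⧸ Z)⁆ := by
    refine (commutatorElement_eq_one_iff_mul_comm.1 ?_).symm
    exact (QuotientGroup.eq_one_iff (⁅⁅a, b⁆, a⁆)).2 <| commutator_mem_commutator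
      (commutator_mem_commutator (mem_top _) (mem_top _)) (mem_top _)
  have hpow (n : ℤ) : ((⁅a ^ n, b⁆ : G) : G ⧸ Z) = (c ^ n : G) := by
    have := commutatorElement_zpow_left hcomm n
    exact this
  have hc4 : c ^ (4 : ℤ) ∈ Z := by
    rw [← QuotientGroup.eq_one_iff, ← hpow, show a ^ (4 : ℤ) = 1 by exact_mod_cast ha]
    simp
  have hcong {m n : ZMod 4 → G} (hm : m ∈ M) (h : ∀ x, (m x : G ⧸ Z) = n x) : n ∈ M := by
    rw [← mul_inv_cancel_left m n]
    exact mul_mem hm (mem_sup_right fun x _ => QuotientGroup.eq.1 (h x))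
  let T : AddSubgroup (ZMod 4 → ℤ) := AddSubgroup.toSubgroup.symm (M.comap (piZPow c))
  have hT (v : ZMod 4 → ℤ) : v ∈ T ↔ (fun x => c ^ v x) ∈ M := Iff.rfl
  have hT4 (i : ZMod 4) : (4 : ℤ) • (Pi.single i 1 : ZMod 4 → ℤ) ∈ T := by
    refine (hT _).2 (mem_sup_right fun x _ => ?_)
    change c ^ _ ∈ Z
    rw [Pi.smul_apply, smul_eq_mul, zpow_mul]
    exact zpow_mem hc4 _
  have hTr (i : ZMod 4) :
      p 0 • (Pi.single i 1 : ZMod 4 → ℤ) + (-p 2) • Pi.single (i - 1) 1 ∈ T := by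
    -- In neighbouring translates, `b` meets a^(p 0) at coordinate `i` and a^(p 2) at `i - 1`; at
    -- the other two coordinates powers of `a` commute.
    have hmem : ⁅fun x => f (x - i), fun x => f (x - (i + 1))⁆ ∈ M := by
      rw [commutatorElement_def]
      exact mem_sup_left
        (mul_mem (mul_mem (mul_mem (hN _) (hN _)) (inv_mem (hN _))) (inv_mem (hN _)))
    refine (hT _).2 (hcong hmem fun x => ?_)
    change ((⁅f (x - i), f (x - (i + 1))⁆ : G) : G ⧸ Z) = _
    obtain ⟨y, rfl⟩ : ∃ y, x = y + i := ⟨x - i, by ring⟩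
    rw [add_sub_cancel_right, show y + i - (i + 1) = y - 1 by ring]
    have h3 : y = 0 ∨ y = 1 ∨ y = 2 ∨ y = 3 := by revert y; decide
    rcases h3 with rfl | rfl | rfl | rfl
    · rw [show (0 - 1 : ZMod 4) = 3 by decide, hb, hf 0 (by decide), hpow]
      have : i ≠ i - 1 := (by decide : ∀ i : ZMod 4, i ≠ i - 1) i
      simp [this]
    · rw [sub_self, hf 0 (by decide), hf 1 (by decide)]
      have h1 : 1 + i ≠ i - 1 := (by decide : ∀ i : ZMod 4, 1 + i ≠ i - 1) i
      have h2 : 1 + i ≠ i := (by decide : ∀ i : ZMod 4, 1 + i ≠ i) i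
      rw [((Commute.refl a).zpow_zpow _ _).commutator_eq]
      simp [h1, h2]
    · rw [show (2 - 1 : ZMod 4) = 1 by decide, hf 2 (by decide), hf 1 (by decide)]
      have h1 : 2 + i ≠ i - 1 := (by decide : ∀ i : ZMod 4, 2 + i ≠ i - 1) i
      have h2 : 2 + i ≠ i := (by decide : ∀ i : ZMod 4, 2 + i ≠ i) i
      rw [((Commute.refl a).zpow_zpow _ _).commutator_eq]
      simp [h1, h2]
    · rw [show (3 - 1 : ZMod 4) = 2 by decide, hb, hf 2 (by decide), ← commutatorElement_inv,
        QuotientGroup.mk_inv, hpow, show (3 + i : ZMod 4) = i - 1 by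
          rw [show (3 : ZMod 4) = -1 by decide]; ring]
      have : i - 1 ≠ i := (by decide : ∀ i : ZMod 4, i - 1 ≠ i) i
      simp [this]
  have hsingle (i : ZMod 4) : (Pi.single i 1 : ZMod 4 → ℤ) ∈ T := by
    rcases hp with ⟨h0, h2⟩ | ⟨h0, h2⟩
    · exact mem_of_odd_smul_add_even_smul_mem (u := fun i => (Pi.single i 1 : ZMod 4 → ℤ))
        (s := fun i => i - 1) h0 h2.neg hT4 hTr i
    -- Here the odd coefficient sits at `i - 1`, so the relation is reindexed and the shift runs the
    -- other way.
    · refine mem_of_odd_smul_add_even_smul_mem (u := fun i => (Pi.single i 1 : ZMod 4 → ℤ))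
        (s := fun i => i + 1) h2.neg h0 hT4 (fun i => ?_) i
      have := hTr (i + 1)
      rwa [add_sub_cancel_right, add_comm] at this
  rw [pi_le_iff]
  intro i
  rw [Subgroup.map_le_iff_le_comap]
  -- Conjugation in one coordinate is induced by an element of `N`; hence having `c` in this
  -- preimage is enough to have all of G'.
  have hnormal : (M.comap (MonoidHom.mulSingle (fun _ : ZMod 4 => G) i)).Normal := by
    refine ⟨fun h hh g => ?_⟩
    obtain ⟨n, hn, rfl⟩ := eq_comap_top_of_map_evalMonoidHom (hsub i) g
    have hn' : n ∈ M := mem_sup_left hn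
    have : (MonoidHom.mulSingle (fun _ : ZMod 4 => G) i) (n i * h * (n i)⁻¹) =
        n * (MonoidHom.mulSingle (fun _ : ZMod 4 => G) i) h * n⁻¹ := by
      funext j
      by_cases hj : j = i
      · subst hj; simp
      · simp [hj]
    rw [Subgroup.mem_comap] at hh ⊢
    rw [this]
    exact mul_mem (mul_mem hn' hh) (inv_mem hn')
  refine lowerCentralSeries_one_le_of_commutatorElement_mem hab ?_
  rw [Subgroup.mem_comap]
  convert (hT _).1 (hsingle i) using 1
  funext j
  by_cases hj : j = i
  · subst hj; simp [hc, commutatorElement_def]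
  · simp [hj, commutatorElement_def]

end

/-! ### Sections, level indices and closures in the automorphism group of the tree -/

namespace AutT

variable {m : ℕ}

theorem exists_apply_append_list (f : AutT m) (u w : List (Fin m)) :
    ∃ w', f (u ++ w) = f u ++ w' := by
  induction w using List.reverseRecOn with
  | nil => exact ⟨[], by simp⟩
  | append_singleton w x ih =>
    obtain ⟨w', h⟩ := ih
    obtain ⟨y, hy⟩ := exists_apply_append f (u ++ w) x
    exact ⟨w' ++ [y], by rw [← List.append_assoc, hy, h, List.append_assoc]⟩

/-- The action on words of the automorphism fixing the first level with sections `f x`. -/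
def sectionsFun (f : Fin m → AutT m) : List (Fin m) → List (Fin m)
  | [] => []
  | x :: w => x :: f x w

theorem sectionsFun_append (f : Fin m → AutT m) (u : List (Fin m)) (x : Fin m) :
    ∃ y, sectionsFun f (u ++ [x]) = sectionsFun f u ++ [y] := by
  cases u with
  | nil => exact ⟨x, by simp [sectionsFun]⟩
  | cons z w => simpa [sectionsFun] using exists_apply_append (f z) w x

/-- The homomorphism sending a family `f` to the automorphism fixing the first level whose section
at `x` is `f x`. -/
def ofSections : (Fin m → AutT m) →* AutT m where
  toFun f := mk' ⟨sectionsFun f, sectionsFun f⁻¹,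
    fun v => by cases v <;> simp [sectionsFun], fun v => by cases v <;> simp [sectionsFun]⟩
    rfl (sectionsFun_append f) (sectionsFun_append f⁻¹)
  map_one' := by ext1 v; cases v <;> rfl
  map_mul' f g := by ext1 v; cases v <;> rfl

@[simp] theorem ofSections_cons (f : Fin m → AutT m) (x : Fin m) (w : List (Fin m)) :
    ofSections f (x :: w) = x :: f x w := rfl

theorem ofSections_injective : Function.Injective (ofSections (m := m)) := by
  intro f g h
  funext x
  ext1 w
  have := congrArg (fun k : AutT m => k (x :: w)) h
  simpa using this

theorem ofSections_mem_St_succ {f : Fin m → AutT m} {n : ℕ} :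
    ofSections f ∈ St m (n + 1) ↔ ∀ x, f x ∈ St m n := by
  constructor
  · intro h x w hw
    simpa using h (x :: w) (by simp [hw])
  · rintro h (_ | ⟨x, w⟩) hw
    · rfl
    · rw [ofSections_cons, h x w (by simpa using hw)]

theorem exists_ofSections_eq {g : AutT m} (hg : g ∈ St m 1) : ∃ f, ofSections f = g := by
  have key (h : AutT m) (hh : h ∈ St m 1) (x : Fin m) (w : List (Fin m)) :
      ∃ w', h (x :: w) = x :: w' := by
    obtain ⟨w', hw⟩ := exists_apply_append_list h [x] w
    exact ⟨w', by simpa [hh [x] rfl] using hw⟩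
  choose s hs using key g hg
  choose t ht using key g⁻¹ ((St m 1).inv_mem hg)
  have hst (x : Fin m) (w : List (Fin m)) : s x (t x w) = w := by
    have : g (g⁻¹ (x :: w)) = x :: w := apply_inv_self g _
    rw [ht, hs] at this
    exact List.tail_eq_of_cons_eq this
  have hts (x : Fin m) (w : List (Fin m)) : t x (s x w) = w := by
    have : g⁻¹ (g (x :: w)) = x :: w := inv_apply_self g _
    rw [hs, ht] at this
    exact List.tail_eq_of_cons_eq this
  have happ (h : AutT m) (r : Fin m → List (Fin m) → List (Fin m))
      (hr : ∀ x w, h (x :: w) = x :: r x w) (x : Fin m) (u : List (Fin m)) (z : Fin m) :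
      ∃ y, r x (u ++ [z]) = r x u ++ [y] := by
    obtain ⟨y, hy⟩ := exists_apply_append h (x :: u) z
    exact ⟨y, by simpa [hr] using hy⟩
  refine ⟨fun x => mk' ⟨s x, t x, hts x, hst x⟩ ?_ (happ g s hs x) (happ g⁻¹ t ht x), ?_⟩
  · have := length_apply g [x]
    change s x [] = []
    simpa [hs] using this
  · ext1 v
    cases v with
    | nil => simp
    | cons x w => exact (hs x w).symm

/-- The action of `Aut T_m` on the words of length `n`. -/
def levelHom (m n : ℕ) : AutT m →* Equiv.Perm (List.Vector (Fin m) n) where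
  toFun f := ⟨fun v => ⟨f v.1, (length_apply f _).trans v.2⟩,
    fun v => ⟨f⁻¹ v.1, (length_apply f⁻¹ _).trans v.2⟩,
    fun v => Subtype.ext (inv_apply_self f v.1), fun v => Subtype.ext (apply_inv_self f v.1)⟩
  map_one' := rfl
  map_mul' _ _ := rfl

theorem levelHom_ker (m n : ℕ) : (levelHom m n).ker = St m n := by
  ext f
  constructor
  · intro h v hv
    exact congrArg (fun p : Equiv.Perm (List.Vector (Fin m) n) => (p ⟨v, hv⟩).1) h
  · intro h
    ext1 v
    exact Subtype.ext (h v.1 v.2)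

instance finiteIndex_St (m n : ℕ) : (St m n).FiniteIndex := by
  rw [← levelHom_ker]
  infer_instance

theorem logOrder_eq (G : Subgroup (AutT m)) (n : ℕ) :
    logOrder G n = Real.logb m ((St m n).relIndex G) := rfl

theorem isOpen_St (m n : ℕ) : IsOpen (St m n : Set (AutT m)) := by
  refine Subgroup.isOpen_of_mem_nhds _ (g := 1) ?_
  exact (congruenceBasis m).mem_nhds_one ⟨n, rfl⟩

/-- G·St(n) is an open subgroup, hence closed, so it contains the closure of `G`; the closure
therefore has the same congruence quotients. -/
theorem logOrder_topologicalClosure (G : Subgroup (AutT m)) (n : ℕ) :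
    logOrder G.topologicalClosure n = logOrder G n := by
  have h : G.topologicalClosure ≤ G ⊔ St m n :=
    G.topologicalClosure_minimal le_sup_left
      (Subgroup.isClosed_of_isOpen _ (Subgroup.isOpen_mono le_sup_right (isOpen_St m n)))
  have h2 : G.topologicalClosure ⊔ St m n = G ⊔ St m n :=
    le_antisymm (sup_le h le_sup_right) (sup_le_sup_right G.le_topologicalClosure _)
  rw [logOrder_eq, logOrder_eq, ← Subgroup.relIndex_sup_right (H := G.topologicalClosure), h2,
    Subgroup.relIndex_sup_right]

/-- The homomorphism `ofSections`, restricted to the families with members in `H`. -/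
def ofSectionsIn (H : Subgroup (AutT m)) : (Fin m → H) →* AutT m :=
  ofSections.comp (MonoidHom.pi fun x => H.subtype.comp (Pi.evalMonoidHom _ x))

theorem ofSectionsIn_injective (H : Subgroup (AutT m)) : Function.Injective (ofSectionsIn H) := by
  intro f g h
  funext x
  exact Subtype.ext (congrFun (ofSections_injective h) x)

theorem comap_ofSectionsIn_St_succ (H : Subgroup (AutT m)) (n : ℕ) :
    (St m (n + 1)).comap (ofSectionsIn H) =
      Subgroup.pi Set.univ fun _ => (St m n).subgroupOf H := by
  ext f
  rw [Subgroup.mem_comap]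
  refine ofSections_mem_St_succ.trans ⟨fun h x _ => h x, fun h x => h x trivial⟩

theorem relIndex_St_succ {H : Subgroup (AutT m)} (hH : H ⊓ St m 1 ≤ (ofSectionsIn H).range)
    (n : ℕ) : (St m (n + 1)).relIndex H = (St m 1).relIndex H *
      (Subgroup.pi Set.univ fun _ => (St m n).subgroupOf H).relIndex
        (H.comap (ofSectionsIn H)) := by
  have hrange : (ofSectionsIn H).range ≤ St m 1 := by
    rintro _ ⟨f, rfl⟩
    refine ofSections_mem_St_succ.2 fun x w hw => ?_
    rw [List.length_eq_zero_iff.1 hw, apply_nil]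
  have h1 : (H.comap (ofSectionsIn H)).map (ofSectionsIn H) = St m 1 ⊓ H := by
    rw [Subgroup.map_comap_eq, inf_comm (St m 1)]
    exact le_antisymm (le_inf inf_le_right (inf_le_left.trans hrange)) (le_inf hH inf_le_left)
  rw [← comap_ofSectionsIn_St_succ, Subgroup.relIndex_comap, h1, mul_comm,
    Subgroup.relIndex_inf_mul_relIndex, inf_eq_left.2 (St_antitone (by omega))]

end AutT

/-! ### The generators `a` and `b`, and the ambient group `W4` -/

namespace GGS

open AutT

/-- The word with first letter `x`, the letters being regarded as residues modulo `4`. -/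
def consWord (x : ZMod 4) (w : List (Fin 4)) : List (Fin 4) := x :: w

theorem consWord_append (x : ZMod 4) (u v : List (Fin 4)) :
    consWord x (u ++ v) = consWord x u ++ v := rfl

theorem consWord_inj {x y : ZMod 4} {u v : List (Fin 4)} :
    consWord x u = consWord y v ↔ x = y ∧ u = v := List.cons_eq_cons

theorem length_consWord (x : ZMod 4) (w : List (Fin 4)) :
    (consWord x w).length = w.length + 1 := rfl

theorem word_induction {P : List (Fin 4) → Prop} (nil : P [])
    (cons : ∀ x w, P w → P (consWord x w)) (v : List (Fin 4)) : P v := by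
  induction v with
  | nil => exact nil
  | cons x w ih => exact cons x w ih

theorem ext_consWord {f g : AutT 4} (h : ∀ x w, f (consWord x w) = g (consWord x w)) : f = g := by
  ext1 v
  induction v using word_induction with
  | nil => simp
  | cons x w _ => exact h x w

/-- The rooted automorphism translating the first letter by `t`. -/
def shift (t : ZMod 4) : AutT 4 := rooted (Equiv.addRight t)

theorem shift_consWord (t x : ZMod 4) (w : List (Fin 4)) :
    shift t (consWord x w) = consWord (x + t) w := rfl

theorem shift_zero : shift 0 = 1 :=
  ext_consWord fun x w => by rw [shift_consWord, add_zero, one_apply]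

theorem shift_add (s t : ZMod 4) : shift (s + t) = shift s * shift t :=
  ext_consWord fun x w => by
    rw [mul_apply, shift_consWord, shift_consWord, shift_consWord, add_assoc, add_comm t s]

theorem cycle_eq : cycle = Equiv.addRight (1 : ZMod 4) :=
  Equiv.ext fun x => by revert x; decide

theorem shift_one : shift 1 = a := by
  rw [a, cycle_eq]
  rfl

theorem shift_neg (t : ZMod 4) : shift (-t) = (shift t)⁻¹ :=
  eq_inv_of_mul_eq_one_left (by rw [← shift_add, neg_add_cancel, shift_zero])

theorem a_pow (n : ℕ) : a ^ n = shift n := by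
  induction n with
  | zero => simp [shift_zero]
  | succ n ih => rw [pow_succ, ih, Nat.cast_succ, shift_add, shift_one]

theorem a_pow_val (t : ZMod 4) : a ^ t.val = shift t := by rw [a_pow, ZMod.natCast_zmod_val]

theorem a_pow_four : a ^ 4 = 1 := by rw [a_pow, ← shift_zero]; rfl

theorem shift_mem_St_one {t : ZMod 4} : shift t ∈ St 4 1 ↔ t = 0 := by
  constructor
  · intro h
    have := h (consWord 0 []) rfl
    rw [shift_consWord, consWord_inj, zero_add] at this
    exact this.1
  · rintro rfl
    rw [shift_zero]
    exact one_mem _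

/-- The homomorphism `ofSections`, for families indexed by `ℤ/4ℤ`. -/
def diag : (ZMod 4 → AutT 4) →* AutT 4 := ofSections

theorem diag_consWord (f : ZMod 4 → AutT 4) (x : ZMod 4) (w : List (Fin 4)) :
    diag f (consWord x w) = consWord x (f x w) := rfl

theorem shift_mul_diag (t : ZMod 4) (f : ZMod 4 → AutT 4) :
    shift t * diag f = diag (fun x => f (x - t)) * shift t :=
  ext_consWord fun x w => by
    rw [mul_apply, mul_apply, shift_consWord, diag_consWord, diag_consWord, shift_consWord,
      add_sub_cancel_right]

theorem diag_mul_shift_mul (f g : ZMod 4 → AutT 4) (s t : ZMod 4) :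
    diag f * shift s * (diag g * shift t) = diag (f * fun x => g (x - s)) * shift (s + t) := by
  rw [map_mul, shift_add, mul_assoc, ← mul_assoc (shift s), shift_mul_diag]
  simp only [mul_assoc]

theorem diag_mul_shift_inv (f : ZMod 4 → AutT 4) (s : ZMod 4) :
    (diag f * shift s)⁻¹ = diag (fun x => (f (x + s))⁻¹) * shift (-s) := by
  refine inv_eq_of_mul_eq_one_right ?_
  rw [diag_mul_shift_mul, add_neg_cancel, shift_zero, mul_one, ← map_one diag]
  congr 1
  funext x
  simp

theorem diag_mem_St_one (f : ZMod 4 → AutT 4) : diag f ∈ St 4 1 :=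
  ofSections_mem_St_succ.2 fun x w hw => by rw [List.length_eq_zero_iff.1 hw, apply_nil]

theorem diag_mul_shift_mem_St_one {f : ZMod 4 → AutT 4} {t : ZMod 4} :
    diag f * shift t ∈ St 4 1 ↔ t = 0 := by
  rw [Subgroup.mul_mem_cancel_left _ (diag_mem_St_one f), shift_mem_St_one]

/-- The exponents of the sections of `b`, other than the section `b` itself. -/
def sectionExponent (e : Fin 3 → ZMod 4) : ZMod 4 → ZMod 4 := ![e 0, e 1, e 2, 0]

/-- The sections of `b`. -/
def bSection (e : Fin 3 → ZMod 4) (x : ZMod 4) : AutT 4 :=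
  if x = 3 then b e else shift (sectionExponent e x)

theorem b_consWord (e : Fin 3 → ZMod 4) (x : ZMod 4) (w : List (Fin 4)) :
    b e (consWord x w) = consWord x (bSection e x w) := by
  change consWord x (if x = 3 then b e w else
    ![a ^ (e 0).val, a ^ (e 1).val, a ^ (e 2).val, (1 : AutT 4)] x w) = _
  rw [bSection]
  split_ifs with hx
  · rfl
  · have : ![a ^ (e 0).val, a ^ (e 1).val, a ^ (e 2).val, (1 : AutT 4)] x =
        shift (sectionExponent e x) := by
      fin_cases x
      · exact a_pow_val _
      · exact a_pow_val _
      · exact a_pow_val _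
      · exact absurd rfl hx
    rw [this]

theorem diag_bSection (e : Fin 3 → ZMod 4) : diag (bSection e) = b e :=
  ext_consWord fun x w => by rw [b_consWord, diag_consWord]

theorem b_pow_four (e : Fin 3 → ZMod 4) : b e ^ 4 = 1 := by
  have hs (t : ZMod 4) : shift t ^ 4 = 1 := by
    rw [← a_pow_val, ← pow_mul, mul_comm, pow_mul, a_pow_four, one_pow]
  ext1 v
  rw [one_apply]
  induction v using word_induction with
  | nil => exact apply_nil _
  | cons x w ih =>
    rw [← diag_bSection, ← map_pow, diag_consWord, Pi.pow_apply, bSection]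
    split_ifs
    · rw [ih]
    · rw [hs, one_apply]

theorem addRight_zpow (n : ℤ) :
    (Equiv.addRight (1 : ZMod 4)) ^ n = Equiv.addRight (n : ZMod 4) := by
  let φ : Multiplicative (ZMod 4) →* Equiv.Perm (ZMod 4) :=
    { toFun := fun t => Equiv.addRight t.toAdd
      map_one' := Equiv.ext fun x => add_zero x
      map_mul' := fun s t => Equiv.ext fun x =>
        show x + (s.toAdd + t.toAdd) = x + t.toAdd + s.toAdd by ring }
  have h := map_zpow φ (Multiplicative.ofAdd 1) n
  rw [← ofAdd_zsmul, zsmul_one] at h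
  exact h.symm

theorem mem_zpowers_cycle {σ : Equiv.Perm (Fin 4)} :
    σ ∈ Subgroup.zpowers cycle ↔ ∃ t : ZMod 4, σ = Equiv.addRight t := by
  rw [Subgroup.mem_zpowers_iff, cycle_eq]
  constructor
  · rintro ⟨n, rfl⟩
    exact ⟨n, addRight_zpow n⟩
  · rintro ⟨t, rfl⟩
    exact ⟨t.val, (addRight_zpow _).trans (by simp)⟩

theorem mem_W4 {f : AutT 4} : f ∈ W4 ↔ ∀ v, ∃ t : ZMod 4, ∀ x : ZMod 4,
    f (v ++ consWord x []) = f v ++ consWord (x + t) [] := by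
  refine forall_congr' fun v => ⟨?_, ?_⟩
  · rintro ⟨σ, hσ, h⟩
    obtain ⟨t, rfl⟩ := mem_zpowers_cycle.1 hσ
    exact ⟨t, h⟩
  · rintro ⟨t, h⟩
    exact ⟨_, mem_zpowers_cycle.2 ⟨t, rfl⟩, h⟩

theorem exists_apply_singleton_of_mem_W4 {g : AutT 4} (hg : g ∈ W4) :
    ∃ t : ZMod 4, ∀ x : ZMod 4, g (consWord x []) = consWord (x + t) [] := by
  obtain ⟨t, h⟩ := mem_W4.1 hg []
  rw [apply_nil] at h
  exact ⟨t, h⟩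

theorem shift_mem_W4 (t : ZMod 4) : shift t ∈ W4 := by
  rw [mem_W4]
  intro v
  induction v using word_induction with
  | nil => exact ⟨t, fun x => rfl⟩
  | cons y w _ => exact ⟨0, fun x => by
      rw [← consWord_append, shift_consWord, shift_consWord, consWord_append, add_zero]⟩

theorem shift_mem {H : Subgroup (AutT 4)} (ha : a ∈ H) (t : ZMod 4) : shift t ∈ H := by
  rw [← a_pow_val]
  exact pow_mem ha _

theorem diag_mem_W4_iff {f : ZMod 4 → AutT 4} : diag f ∈ W4 ↔ ∀ x, f x ∈ W4 := by
  simp_rw [mem_W4]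
  constructor
  · intro h x w
    obtain ⟨t, ht⟩ := h (consWord x w)
    refine ⟨t, fun y => ?_⟩
    have := ht y
    rw [← consWord_append, diag_consWord, diag_consWord, ← consWord_append, consWord_inj] at this
    exact this.2
  · intro h v
    induction v using word_induction with
    | nil =>
      exact ⟨0, fun x => by rw [List.nil_append, diag_consWord, apply_nil, apply_nil, add_zero]; rfl⟩
    | cons x w _ =>
      obtain ⟨t, ht⟩ := h x w
      exact ⟨t, fun y => by
        rw [← consWord_append, diag_consWord, diag_consWord, ht, consWord_append]⟩

theorem b_mem_W4 (e : Fin 3 → ZMod 4) : b e ∈ W4 := by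
  rw [mem_W4]
  intro v
  induction v using word_induction with
  | nil =>
    refine ⟨0, fun x => ?_⟩
    rw [List.nil_append, b_consWord, apply_nil, apply_nil, add_zero]
    rfl
  | cons x w ih =>
    have key : ∃ t : ZMod 4, ∀ y, bSection e x (w ++ consWord y []) =
        bSection e x w ++ consWord (y + t) [] := by
      rw [bSection]
      split_ifs
      · exact ih
      · exact mem_W4.1 (shift_mem_W4 _) w
    obtain ⟨t, ht⟩ := key
    exact ⟨t, fun y => by rw [← consWord_append, b_consWord, b_consWord, ht, consWord_append]⟩

theorem group_le_W4 (e : Fin 3 → ZMod 4) : group e ≤ W4 :=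
  (Subgroup.closure_le _).2 (by
    rintro x (rfl | rfl)
    exacts [shift_one ▸ shift_mem_W4 1, b_mem_W4 e])

/-- Once level `n` is fixed, the labels at its vertices are translations of ℤ/4, which one further
fourth power kills. -/
theorem pow_four_pow_mem_St {g : AutT 4} (hg : g ∈ W4) (n : ℕ) : g ^ 4 ^ n ∈ St 4 n := by
  induction n with
  | zero =>
    intro v hv
    rw [List.length_eq_zero_iff.1 hv, apply_nil]
  | succ n ih =>
    intro v hv
    obtain ⟨w, x, rfl⟩ : ∃ w x, v = w ++ consWord x [] :=
      (List.eq_nil_or_concat' v).resolve_left (by rintro rfl; simp at hv)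
    have hw : w.length = n := by simpa [length_consWord] using hv
    obtain ⟨t, ht⟩ := mem_W4.1 (pow_mem hg (4 ^ n)) w
    rw [ih w hw] at ht
    have h4 : t + t + t + t = 0 := (by decide : ∀ t : ZMod 4, t + t + t + t = 0) t
    rw [pow_succ, pow_mul]
    change (g ^ 4 ^ n) ((g ^ 4 ^ n) ((g ^ 4 ^ n) ((g ^ 4 ^ n) (w ++ consWord x [])))) = _
    rw [ht, ht, ht, ht, show x + t + t + t + t = x by linear_combination h4]

/-- The subgroups of `W_4` containing `a` have index `4` over their first level stabilizer. -/
theorem relIndex_St_one {H : Subgroup (AutT 4)} (hW : H ≤ W4) (ha : a ∈ H) :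
    (St 4 1).relIndex H = 4 := by
  have h1 : H ⊔ St 4 1 = Subgroup.zpowers a ⊔ St 4 1 := by
    refine le_antisymm (sup_le (fun g hg => ?_) le_sup_right)
      (sup_le_sup_right (Subgroup.zpowers_le.2 ha) _)
    obtain ⟨t, ht⟩ := exists_apply_singleton_of_mem_W4 (hW hg)
    rw [← mul_inv_cancel_left (shift t) g]
    refine mul_mem (Subgroup.mem_sup_left (shift_mem (Subgroup.mem_zpowers a) t))
      (Subgroup.mem_sup_right fun v hv => ?_)
    obtain ⟨x, rfl⟩ : ∃ x, v = consWord x [] := List.length_eq_one_iff.1 hv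
    rw [← shift_neg, mul_apply, ht, shift_consWord, add_neg_cancel_right]
  have h2 : Disjoint (St 4 1) (Subgroup.zpowers a) := by
    rw [Subgroup.disjoint_def]
    intro g hg hz
    obtain ⟨n, rfl⟩ : ∃ n : ℕ, a ^ n = g := by
      refine (Submonoid.mem_powers_iff _ _).1 ?_
      refine (IsOfFinOrder.mem_powers_iff_mem_zpowers ?_).2 hz
      exact isOfFinOrder_iff_pow_eq_one.2 ⟨4, by norm_num, a_pow_four⟩
    rw [a_pow, shift_mem_St_one] at hg
    rw [a_pow, hg, shift_zero]
  have h3 : orderOf a = 4 := by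
    refine orderOf_eq_prime_pow (p := 2) (n := 1) (fun h => ?_) a_pow_four
    have h5 : shift ((2 : ℕ) : ZMod 4) ∈ St 4 1 := by
      rw [← a_pow, show 2 = 2 ^ 1 by rfl, h]; exact one_mem _
    exact absurd (shift_mem_St_one.1 h5) (by decide)
  rw [← Subgroup.relIndex_sup_right (H := H) (K := St 4 1), h1, Subgroup.relIndex_sup_right,
    ← Subgroup.inf_relIndex_right, h2.eq_bot, Subgroup.relIndex_bot_left, Nat.card_zpowers, h3]

/-- Sections in `W4` can be prescribed freely, so passing to the next level takes the fourth power
of the index and multiplies it by 4. -/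
theorem relIndex_St_W4 (n : ℕ) : (St 4 n).relIndex W4 = 4 ^ ∑ i ∈ Finset.range n, 4 ^ i := by
  induction n with
  | zero =>
    rw [Finset.sum_range_zero, pow_zero, Subgroup.relIndex_eq_one]
    intro g _ v hv
    rw [List.length_eq_zero_iff.1 hv, apply_nil]
  | succ n ih =>
    have htop : W4.comap (ofSectionsIn W4) = ⊤ :=
      eq_top_iff.2 fun f _ => diag_mem_W4_iff.2 fun x => (f x).2
    have hsec : W4 ⊓ St 4 1 ≤ (ofSectionsIn W4).range := by
      rintro g ⟨hg, hg1⟩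
      obtain ⟨f, rfl⟩ := exists_ofSections_eq hg1
      exact ⟨fun x => ⟨f x, diag_mem_W4_iff.1 hg x⟩, rfl⟩
    have h4 : (St 4 n).relIndex W4 = ((St 4 n).subgroupOf W4).index := rfl
    rw [relIndex_St_succ hsec, htop, Subgroup.relIndex_top_right, Subgroup.index_pi,
      Finset.prod_const, ← h4, ih, relIndex_St_one le_rfl (shift_one ▸ shift_mem_W4 1),
      Finset.card_univ, Fintype.card_fin, ← pow_mul, ← pow_succ', Finset.sum_range_succ',
      Finset.sum_mul]
    simp only [pow_succ, pow_zero]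

end GGS

/-- Modulo G' every element is aⁱbʲ, and `φ` reads off `i` and `j` modulo 4, which is all that
matters as a⁴ = b⁴ = 1. -/
theorem ker_le_lowerCentralSeries_one {G : Type*} [Group G] {a b : G}
    (hab : Subgroup.closure {a, b} = ⊤) (ha : a ^ 4 = 1) (hb : b ^ 4 = 1)
    {φ : G →* Multiplicative (ZMod 4 × ZMod 4)} (hφa : φ a = .ofAdd (1, 0))
    (hφb : φ b = .ofAdd (0, 1)) : φ.ker ≤ (⊤ : Subgroup G).lowerCentralSeries 1 := by
  have key (g : G) (hg : g ∈ Subgroup.closure {a, b}) :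
      ∃ i j : ℤ, Abelianization.of g = Abelianization.of (a ^ i * b ^ j) := by
    induction hg using Subgroup.closure_induction with
    | mem x hx =>
      rcases hx with rfl | rfl
      · exact ⟨1, 0, by simp⟩
      · exact ⟨0, 1, by simp⟩
    | one => exact ⟨0, 0, by simp⟩
    | mul x y _ _ hx hy =>
      obtain ⟨i, j, h⟩ := hx
      obtain ⟨k, l, h'⟩ := hy
      refine ⟨i + k, j + l, ?_⟩
      simp only [map_mul, h, h', zpow_add]
      exact mul_mul_mul_comm _ _ _ _
    | inv x _ hx =>
      obtain ⟨i, j, h⟩ := hx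
      refine ⟨-i, -j, ?_⟩
      rw [map_inv, h, map_mul, map_mul, mul_inv, zpow_neg, zpow_neg, map_inv, map_inv]
  intro g hg
  obtain ⟨i, j, h⟩ := key g (hab ▸ Subgroup.mem_top g)
  have h1 := congrArg (Abelianization.lift φ) h
  rw [Abelianization.lift_apply_of, Abelianization.lift_apply_of, MonoidHom.mem_ker.1 hg, map_mul,
    map_zpow, map_zpow, hφa, hφb, ← ofAdd_zsmul, ← ofAdd_zsmul, ← ofAdd_add, eq_comm,
    ofAdd_eq_one] at h1
  have hi : (i : ZMod 4) = 0 := by simpa using congrArg Prod.fst h1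
  have hj : (j : ZMod 4) = 0 := by simpa using congrArg Prod.snd h1
  obtain ⟨i, rfl⟩ := (ZMod.intCast_zmod_eq_zero_iff_dvd _ _).1 hi
  obtain ⟨j, rfl⟩ := (ZMod.intCast_zmod_eq_zero_iff_dvd _ _).1 hj
  have ha' : a ^ ((4 : ℕ) : ℤ) = 1 := by exact_mod_cast ha
  have hb' : b ^ ((4 : ℕ) : ℤ) = 1 := by exact_mod_cast hb
  rw [zpow_mul, zpow_mul, ha', hb', one_zpow, one_zpow, mul_one, map_one] at h
  exact (QuotientGroup.eq_one_iff g).1 h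

/-! ### Linear algebra modulo 4: kernel and image of the circulant -/

namespace GGS

open AutT

/-- The exponents of `a` at the first level vertices in terms of the exponents of `b`. -/
def circulant (e : Fin 3 → ZMod 4) : (ZMod 4 → ZMod 4) →+ (ZMod 4 → ZMod 4) where
  toFun r x := e 0 * r (x - 1) + e 1 * r (x - 2) + e 2 * r (x - 3)
  map_zero' := by ext; simp
  map_add' r s := by ext; simp; ring

theorem circulant_apply (e : Fin 3 → ZMod 4) (r : ZMod 4 → ZMod 4) (x : ZMod 4) :
    circulant e r x = e 0 * r (x - 1) + e 1 * r (x - 2) + e 2 * r (x - 3) := rfl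

theorem circulant_translate (e : Fin 3 → ZMod 4) (r : ZMod 4 → ZMod 4) (s x : ZMod 4) :
    circulant e (fun y => r (y + s)) x = circulant e r (x + s) := by
  simp only [circulant_apply]
  ring_nf

theorem circulant_single (e : Fin 3 → ZMod 4) :
    circulant e (Pi.single 3 1) = sectionExponent e := by
  funext x
  have h : x = 0 ∨ x = 1 ∨ x = 2 ∨ x = 3 := by revert x; decide
  rcases h with rfl | rfl | rfl | rfl
  · change e 0 * 1 + e 1 * 0 + e 2 * 0 = e 0; ring
  · change e 0 * 0 + e 1 * 1 + e 2 * 0 = e 1; ring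
  · change e 0 * 0 + e 1 * 0 + e 2 * 1 = e 2; ring
  · change e 0 * 0 + e 1 * 0 + e 2 * 0 = 0; ring

theorem sum_zmod_four {M : Type*} [AddCommMonoid M] (f : ZMod 4 → M) :
    ∑ x, f x = f 0 + f 1 + f 2 + f 3 := Fin.sum_univ_four f

theorem isUnit_iff_odd_val (x : ZMod 4) : IsUnit x ↔ Odd x.val := by
  revert x
  decide

theorem odd_iff_odd_val (x : ZMod 4) : Odd x ↔ Odd x.val := by
  have h : (∃ k, x = 2 * k + 1) ↔ Odd x.val := by
    revert x
    decide
  exact h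

theorem val_parity_of_not_isInvertibleSymmetric {e : Fin 3 → ZMod 4}
    (he : ¬ IsInvertibleSymmetric e) :
    Odd (e 0).val ∧ Even (e 2).val ∨ Even (e 0).val ∧ Odd (e 2).val := by
  by_contra h
  refine he fun i => ?_
  rw [isUnit_iff_odd_val, isUnit_iff_odd_val]
  simp only [← Nat.not_odd_iff_even] at h
  fin_cases i
  · change Odd (e 0).val ↔ Odd (e 2).val
    tauto
  · rfl
  · change Odd (e 2).val ↔ Odd (e 0).val
    tauto

/-- The weights express the all-ones functional as a combination of the rows of the circulant, so
vectors in its kernel have sum zero. For odd sum constant weights would do; for even sum they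
cannot. -/
theorem exists_weights : ∀ x y z : ZMod 4,
    (Odd x.val ∧ Even z.val ∨ Even x.val ∧ Odd z.val) → ∃ l₀ l₁ l₂ l₃ : ZMod 4,
      l₁ * x + l₂ * y + l₃ * z = 1 ∧ l₂ * x + l₃ * y + l₀ * z = 1 ∧
      l₃ * x + l₀ * y + l₁ * z = 1 ∧ l₀ * x + l₁ * y + l₂ * z = 1 := by
  decide +kernel

theorem circulant_eq_zero_iff {e : Fin 3 → ZMod 4} {r : ZMod 4 → ZMod 4} :
    circulant e r = 0 ↔ (e 0 * r 3 + e 1 * r 2 + e 2 * r 1 = 0 ∧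
      e 0 * r 0 + e 1 * r 3 + e 2 * r 2 = 0 ∧ e 0 * r 1 + e 1 * r 0 + e 2 * r 3 = 0 ∧
      e 0 * r 2 + e 1 * r 1 + e 2 * r 0 = 0) := by
  constructor
  · intro h
    exact ⟨congrFun h 0, congrFun h 1, congrFun h 2, congrFun h 3⟩
  · rintro ⟨h0, h1, h2, h3⟩
    funext x
    have h : x = 0 ∨ x = 1 ∨ x = 2 ∨ x = 3 := by revert x; decide
    rcases h with rfl | rfl | rfl | rfl
    exacts [h0, h1, h2, h3]

theorem sum_eq_zero_of_circulant_eq_zero {e : Fin 3 → ZMod 4} (he : ¬ IsInvertibleSymmetric e)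
    {r : ZMod 4 → ZMod 4} (h : circulant e r = 0) : ∑ x, r x = 0 := by
  obtain ⟨l₀, l₁, l₂, l₃, h0, h1, h2, h3⟩ :=
    exists_weights (e 0) (e 1) (e 2) (val_parity_of_not_isInvertibleSymmetric he)
  obtain ⟨g0, g1, g2, g3⟩ := circulant_eq_zero_iff.1 h
  rw [sum_zmod_four]
  linear_combination -r 0 * h0 - r 1 * h1 - r 2 * h2 - r 3 * h3 + l₀ * g0 + l₁ * g1 + l₂ * g2 +
    l₃ * g3

theorem card_circulant_ker_mul_card_range (e : Fin 3 → ZMod 4) :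
    Nat.card (circulant e).range * Nat.card (circulant e).ker = 4 ^ 4 := by
  rw [← AddSubgroup.index_ker, AddSubgroup.index_mul_card, Nat.card_fun, Nat.card_zmod]

theorem eq_zero_of_circulant_equations_of_even : ∀ x y z : ZMod 4,
    (Odd x.val ∧ Even z.val ∨ Even x.val ∧ Odd z.val) → Even y.val → ∀ r₀ r₁ r₂ r₃ : ZMod 4,
      x * r₃ + y * r₂ + z * r₁ = 0 → x * r₀ + y * r₃ + z * r₂ = 0 → x * r₁ + y * r₀ + z * r₃ = 0 →
      x * r₂ + y * r₁ + z * r₀ = 0 → r₀ = 0 ∧ r₁ = 0 ∧ r₂ = 0 ∧ r₃ = 0 := by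
  decide +kernel

theorem eq_zero_of_circulant_equations_of_odd : ∀ x y z : ZMod 4,
    (Odd x.val ∧ Even z.val ∨ Even x.val ∧ Odd z.val) → Odd y.val → ∀ r₁ r₂ r₃ : ZMod 4,
      x * r₃ + y * r₂ + z * r₁ = 0 → x * 0 + y * r₃ + z * r₂ = 0 → x * r₁ + y * 0 + z * r₃ = 0 →
      x * r₂ + y * r₁ + z * 0 = 0 → r₁ = 0 ∧ r₂ = 0 ∧ r₃ = 0 := by
  decide +kernel

theorem exists_circulant_equations_of_odd : ∀ x y z : ZMod 4,
    (Odd x.val ∧ Even z.val ∨ Even x.val ∧ Odd z.val) → Odd y.val → ∃ r₁ r₂ r₃ : ZMod 4,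
      x * r₃ + y * r₂ + z * r₁ = 0 ∧ x * 1 + y * r₃ + z * r₂ = 0 ∧
      x * r₁ + y * 1 + z * r₃ = 0 ∧ x * r₂ + y * r₁ + z * 1 = 0 := by
  decide +kernel

theorem funext_zmod_four {α : Type*} {f g : ZMod 4 → α} (h0 : f 0 = g 0) (h1 : f 1 = g 1)
    (h2 : f 2 = g 2) (h3 : f 3 = g 3) : f = g := by
  funext x
  have h : x = 0 ∨ x = 1 ∨ x = 2 ∨ x = 3 := by revert x; decide
  rcases h with rfl | rfl | rfl | rfl
  exacts [h0, h1, h2, h3]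

theorem odd_sum_iff {e : Fin 3 → ZMod 4} (he : ¬ IsInvertibleSymmetric e) :
    Odd (e 0 + e 1 + e 2) ↔ Even (e 1).val := by
  have aux : ∀ x y z : ZMod 4, (Odd x.val ∧ Even z.val ∨ Even x.val ∧ Odd z.val) →
      (Odd (x + y + z).val ↔ Even y.val) := by decide +kernel
  rw [odd_iff_odd_val]
  exact aux _ _ _ (val_parity_of_not_isInvertibleSymmetric he)

theorem card_range_circulant_of_odd {e : Fin 3 → ZMod 4} (he : ¬ IsInvertibleSymmetric e)
    (h : Odd (e 0 + e 1 + e 2)) : Nat.card (circulant e).range = 4 ^ 4 := by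
  have hk : (circulant e).ker = ⊥ := by
    rw [eq_bot_iff]
    intro r hr
    obtain ⟨g0, g1, g2, g3⟩ := circulant_eq_zero_iff.1 hr
    obtain ⟨h0, h1, h2, h3⟩ := eq_zero_of_circulant_equations_of_even _ _ _
      (val_parity_of_not_isInvertibleSymmetric he) ((odd_sum_iff he).1 h) _ _ _ _ g0 g1 g2 g3
    exact funext_zmod_four h0 h1 h2 h3
  rw [← card_circulant_ker_mul_card_range e, hk, AddSubgroup.card_bot, mul_one]

/-- The middle entry is odd here. A kernel vector is determined by its entry at 0, and one with
entry 1 exists, so the kernel is isomorphic to ℤ/4. -/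
theorem card_range_circulant_of_not_odd {e : Fin 3 → ZMod 4} (he : ¬ IsInvertibleSymmetric e)
    (h : ¬ Odd (e 0 + e 1 + e 2)) : Nat.card (circulant e).range = 4 ^ 3 := by
  rw [odd_sum_iff he, Nat.not_even_iff_odd] at h
  have hpar := val_parity_of_not_isInvertibleSymmetric he
  obtain ⟨s₁, s₂, s₃, hs⟩ := exists_circulant_equations_of_odd _ _ _ hpar h
  let s : ZMod 4 → ZMod 4 := ![1, s₁, s₂, s₃]
  have hs' : s ∈ (circulant e).ker := circulant_eq_zero_iff.2 hs
  let ε : (circulant e).ker →+ ZMod 4 :=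
    (Pi.evalAddMonoidHom (fun _ : ZMod 4 => ZMod 4) 0).comp (circulant e).ker.subtype
  have hε : Function.Bijective ε := by
    constructor
    · rw [injective_iff_map_eq_zero]
      rintro ⟨r, hr⟩ h0
      change r 0 = 0 at h0
      have h5 := circulant_eq_zero_iff.1 hr
      rw [h0] at h5
      obtain ⟨g0, g1, g2, g3⟩ := h5
      obtain ⟨h1, h2, h3⟩ :=
        eq_zero_of_circulant_equations_of_odd _ _ _ hpar h _ _ _ g0 g1 g2 g3
      exact Subtype.ext (funext_zmod_four h0 h1 h2 h3)
    · intro c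
      refine ⟨c.val • ⟨s, hs'⟩, ?_⟩
      rw [map_nsmul]
      change c.val • (1 : ZMod 4) = c
      simp
  have h4 := card_circulant_ker_mul_card_range e
  rw [Nat.card_congr (Equiv.ofBijective ε hε), Nat.card_zmod] at h4
  omega

/-! ### The exponents of `a` and `b` -/

/-- The generators of the group, together with the exponents of `a` and `b` in a word. -/
def exponentGraph (e : Fin 3 → ZMod 4) :
    Subgroup (AutT 4 × Multiplicative (ZMod 4 × ZMod 4)) :=
  Subgroup.closure {(a, .ofAdd (1, 0)), (b e, .ofAdd (0, 1))}

variable {e : Fin 3 → ZMod 4}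

/-- The relations hold for the generators and survive products and inverses, because multiplication
only translates section families and the circulant commutes with translations. Carrying exponents
along as extra data avoids presupposing that they depend on the automorphism alone. -/
theorem exponentGraph_decomposition {g : AutT 4 × Multiplicative (ZMod 4 × ZMod 4)}
    (hg : g ∈ exponentGraph e) : ∃ f : ZMod 4 → AutT 4 × Multiplicative (ZMod 4 × ZMod 4),
      (∀ x, f x ∈ exponentGraph e) ∧ g.1 = diag (fun x => (f x).1) * shift g.2.toAdd.1 ∧
      g.2.toAdd.2 = ∑ x, (f x).2.toAdd.2 ∧
      (fun x => (f x).2.toAdd.1) = circulant e fun y => (f y).2.toAdd.2 := by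
  have ha : (a, .ofAdd (1, 0)) ∈ exponentGraph e := Subgroup.subset_closure (by simp)
  have hb : (b e, .ofAdd (0, 1)) ∈ exponentGraph e := Subgroup.subset_closure (by simp)
  induction hg using Subgroup.closure_induction with
  | mem g hg =>
    rcases hg with rfl | rfl
    · refine ⟨1, fun _ => one_mem _, ?_, by simp, ?_⟩
      · change a = diag 1 * shift 1
        rw [map_one, one_mul, shift_one]
      · exact ((circulant e).map_zero).symm
    · refine ⟨fun x => (bSection e x, .ofAdd (sectionExponent e x,
        (Pi.single 3 1 : ZMod 4 → ZMod 4) x)), fun x => ?_, ?_, ?_, ?_⟩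
      · by_cases hx : x = 3
        · subst hx
          exact hb
        · have := pow_mem ha (sectionExponent e x).val
          rw [Prod.pow_mk, a_pow_val, ← ofAdd_nsmul] at this
          convert this using 1
          simp [bSection, hx]
      · change b e = diag (bSection e) * shift 0
        rw [diag_bSection, shift_zero, mul_one]
      · rw [sum_zmod_four]
        rfl
      · exact (circulant_single e).symm
  | one =>
    refine ⟨1, fun _ => one_mem _, ?_, by simp, ?_⟩
    · change 1 = diag 1 * shift 0
      rw [map_one, one_mul, shift_zero]
    · exact ((circulant e).map_zero).symm
  | mul g h _ _ ihg ihh =>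
    obtain ⟨f, hf, hg1, hg2, hg3⟩ := ihg
    obtain ⟨f', hf', hh1, hh2, hh3⟩ := ihh
    refine ⟨fun x => f x * f' (x - g.2.toAdd.1), fun x => mul_mem (hf x) (hf' _), ?_, ?_, ?_⟩
    · rw [Prod.fst_mul, hg1, hh1, diag_mul_shift_mul]
      rfl
    · change g.2.toAdd.2 + h.2.toAdd.2 =
        ∑ x, ((f x).2.toAdd.2 + (f' (x - g.2.toAdd.1)).2.toAdd.2)
      rw [Finset.sum_add_distrib, hg2, hh2]
      exact congrArg _
        (Equiv.sum_comp (Equiv.subRight g.2.toAdd.1) fun x => (f' x).2.toAdd.2).symm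
    · have h1 := circulant_translate e (fun y => (f' y).2.toAdd.2) (-g.2.toAdd.1)
      simp only [← sub_eq_add_neg] at h1
      change (fun x => (f x).2.toAdd.1 + (f' (x - g.2.toAdd.1)).2.toAdd.1) =
        circulant e ((fun x => (f x).2.toAdd.2) + fun x => (f' (x - g.2.toAdd.1)).2.toAdd.2)
      rw [map_add, ← hg3]
      funext x
      rw [Pi.add_apply, h1, ← hh3]
  | inv g _ ih =>
    obtain ⟨f, hf, hg1, hg2, hg3⟩ := ih
    refine ⟨fun x => (f (x + g.2.toAdd.1))⁻¹, fun x => inv_mem (hf _), ?_, ?_, ?_⟩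
    · rw [Prod.fst_inv, hg1, diag_mul_shift_inv]
      rfl
    · change -g.2.toAdd.2 = ∑ x, -(f (x + g.2.toAdd.1)).2.toAdd.2
      rw [Finset.sum_neg_distrib, hg2]
      exact congrArg _
        (Equiv.sum_comp (Equiv.addRight g.2.toAdd.1) fun x => (f x).2.toAdd.2).symm
    · have h1 := circulant_translate e (fun y => (f y).2.toAdd.2) g.2.toAdd.1
      change (fun x => -(f (x + g.2.toAdd.1)).2.toAdd.1) =
        circulant e (-fun x => (f (x + g.2.toAdd.1)).2.toAdd.2)
      rw [map_neg]
      funext x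
      rw [Pi.neg_apply, h1, ← hg3]

/-- The sections fix the first level, so their `a`-exponents vanish; their `b`-exponents then lie in
the kernel of the circulant and sum to zero, and this sum is the `b`-exponent of the whole. Applied
to quotients, this shows that exponents are well defined. -/
theorem exponents_eq_one_of_mem_St_two (he : ¬ IsInvertibleSymmetric e)
    {g : AutT 4 × Multiplicative (ZMod 4 × ZMod 4)} (hg : g ∈ exponentGraph e)
    (h2 : g.1 ∈ St 4 2) : g.2 = 1 := by
  obtain ⟨f, hf, h, hsum, hcirc⟩ := exponentGraph_decomposition hg
  have ht : g.2.toAdd.1 = 0 := by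
    have := St_succ_le 1 h2
    rwa [h, diag_mul_shift_mem_St_one] at this
  rw [h, ht, shift_zero, mul_one] at h2
  have hzero : (fun x => (f x).2.toAdd.1) = 0 := by
    funext x
    obtain ⟨f', -, h', -⟩ := exponentGraph_decomposition (hf x)
    have := ofSections_mem_St_succ.1 h2 x
    change (f x).1 ∈ St 4 1 at this
    rwa [h', diag_mul_shift_mem_St_one] at this
  rw [hzero] at hcirc
  exact Prod.ext ht (hsum.trans (sum_eq_zero_of_circulant_eq_zero he hcirc.symm))

theorem map_fst_exponentGraph (e : Fin 3 → ZMod 4) :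
    (exponentGraph e).map (MonoidHom.fst _ _) = group e := by
  rw [exponentGraph, MonoidHom.map_closure, Set.image_pair]
  rfl

theorem exists_exponents (g : group e) : ∃ p, (g.1, p) ∈ exponentGraph e := by
  obtain ⟨⟨g', p⟩, h, h'⟩ := (map_fst_exponentGraph e).ge g.2
  exact ⟨p, by rw [← h']; exact h⟩

theorem exponents_unique (he : ¬ IsInvertibleSymmetric e) {g : AutT 4}
    {p q : Multiplicative (ZMod 4 × ZMod 4)} (hp : (g, p) ∈ exponentGraph e)
    (hq : (g, q) ∈ exponentGraph e) : p = q := by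
  have h := mul_mem hp (inv_mem hq)
  refine mul_inv_eq_one.1 (exponents_eq_one_of_mem_St_two he h ?_)
  change g * g⁻¹ ∈ _
  rw [mul_inv_cancel]
  exact one_mem _

/-- The homomorphism sending an element of the group to the exponents of `a` and `b` in it. -/
def exponents (he : ¬ IsInvertibleSymmetric e) : group e →* Multiplicative (ZMod 4 × ZMod 4) :=
  MonoidHom.mk' (fun g => (exists_exponents g).choose) fun g h =>
    exponents_unique he (exists_exponents (g * h)).choose_spec
      (mul_mem (exists_exponents g).choose_spec (exists_exponents h).choose_spec)

theorem exponents_mem (he : ¬ IsInvertibleSymmetric e) (g : group e) :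
    (g.1, exponents he g) ∈ exponentGraph e := (exists_exponents g).choose_spec

theorem exponents_eq (he : ¬ IsInvertibleSymmetric e) {g : group e}
    {p : Multiplicative (ZMod 4 × ZMod 4)} (h : (g.1, p) ∈ exponentGraph e) :
    exponents he g = p := exponents_unique he (exponents_mem he g) h

/-- The decomposition of an element of the group, and the exponents of its sections. -/
theorem exists_sections (he : ¬ IsInvertibleSymmetric e) (g : group e) :
    ∃ f : ZMod 4 → group e,
      g.1 = diag (fun x => (f x).1) * shift (exponents he g).toAdd.1 ∧
      (fun x => (exponents he (f x)).toAdd.1) =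
        circulant e fun y => (exponents he (f y)).toAdd.2 := by
  obtain ⟨f, hf, h, -, hcirc⟩ := exponentGraph_decomposition (exponents_mem he g)
  refine ⟨fun x => ⟨(f x).1, ?_⟩, h, ?_⟩
  · rw [← map_fst_exponentGraph]
    exact ⟨f x, hf x, rfl⟩
  · have hx (x : ZMod 4) (hm : (f x).1 ∈ group e) : exponents he ⟨(f x).1, hm⟩ = (f x).2 :=
      exponents_eq he (hf x)
    simpa only [hx] using hcirc

/-! ### The section families of the first level stabilizer -/

theorem a_mem_group (e : Fin 3 → ZMod 4) : a ∈ group e := Subgroup.subset_closure (by simp)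

theorem b_mem_group (e : Fin 3 → ZMod 4) : b e ∈ group e := Subgroup.subset_closure (by simp)

theorem closure_generators (e : Fin 3 → ZMod 4) :
    Subgroup.closure {(⟨a, a_mem_group e⟩ : group e), ⟨b e, b_mem_group e⟩} = ⊤ := by
  have := Subgroup.closure_closure_coe_preimage (k := {a, b e})
  refine Eq.trans (congrArg _ ?_) this
  ext x
  exact or_congr Subtype.ext_iff Subtype.ext_iff

/-- The homomorphism `diag`, restricted to the families with members in `H`. -/
def diagIn (H : Subgroup (AutT 4)) : (ZMod 4 → H) →* AutT 4 := ofSectionsIn H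

theorem diagIn_injective (H : Subgroup (AutT 4)) : Function.Injective (diagIn H) :=
  ofSectionsIn_injective H

/-- The sections of the elements of the first level stabilizer of the group. -/
def sectionGroup (e : Fin 3 → ZMod 4) : Subgroup (ZMod 4 → group e) :=
  (group e).comap (diagIn (group e))

/-- The power of the `n`th level stabilizer of the group. -/
def stabilizerPower (e : Fin 3 → ZMod 4) (n : ℕ) : Subgroup (ZMod 4 → group e) :=
  Subgroup.pi Set.univ fun _ => (St 4 n).subgroupOf (group e)

instance (n : ℕ) : (stabilizerPower e n).Normal := Subgroup.normal_pi_univ _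

theorem index_stabilizerPower (e : Fin 3 → ZMod 4) (n : ℕ) :
    (stabilizerPower e n).index = (St 4 n).relIndex (group e) ^ 4 := by
  have h4 : (St 4 n).relIndex (group e) = ((St 4 n).subgroupOf (group e)).index := rfl
  rw [stabilizerPower, Subgroup.index_pi, Finset.prod_const, ← h4, Finset.card_univ, ZMod.card]

theorem relIndex_St_succ_group (he : ¬ IsInvertibleSymmetric e) (n : ℕ) :
    (St 4 (n + 1)).relIndex (group e) = 4 * (stabilizerPower e n).relIndex (sectionGroup e) := by
  have h : group e ⊓ St 4 1 ≤ (ofSectionsIn (group e)).range := by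
    rintro g ⟨hg, hg1⟩
    obtain ⟨f, hf, -⟩ := exists_sections he ⟨g, hg⟩
    change g = _ at hf
    change g ∈ St 4 1 at hg1
    rw [hf, diag_mul_shift_mem_St_one] at hg1
    rw [hg1, shift_zero, mul_one] at hf
    exact ⟨f, hf.symm⟩
  have := relIndex_St_succ h n
  rw [relIndex_St_one (group_le_W4 e) (a_mem_group e)] at this
  exact this

theorem exponents_of_mem_sectionGroup (he : ¬ IsInvertibleSymmetric e) {f : ZMod 4 → group e}
    (hf : f ∈ sectionGroup e) : (fun x => (exponents he (f x)).toAdd.1) =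
      circulant e fun y => (exponents he (f y)).toAdd.2 := by
  obtain ⟨f', h, hcirc⟩ := exists_sections he ⟨diagIn (group e) f, hf⟩
  have ht : (exponents he ⟨diagIn (group e) f, hf⟩).toAdd.1 = 0 := by
    rw [← diag_mul_shift_mem_St_one, ← h]
    exact diag_mem_St_one _
  rw [ht, shift_zero, mul_one] at h
  rwa [← diagIn_injective _ (a₁ := f) (a₂ := f') h] at hcirc

theorem exponents_fst_eq_zero_iff (he : ¬ IsInvertibleSymmetric e) (g : group e) :
    (exponents he g).toAdd.1 = 0 ↔ g.1 ∈ St 4 1 := by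
  obtain ⟨f, h, -⟩ := exists_sections he g
  rw [h, diag_mul_shift_mem_St_one]

theorem exponents_eq_one_of_mem_St (he : ¬ IsInvertibleSymmetric e) {g : group e} {n : ℕ}
    (hn : 2 ≤ n) (hg : g.1 ∈ St 4 n) : exponents he g = 1 :=
  exponents_eq_one_of_mem_St_two he (exponents_mem he g) (St_antitone hn hg)

theorem exponents_a (he : ¬ IsInvertibleSymmetric e) :
    exponents he ⟨a, a_mem_group e⟩ = .ofAdd (1, 0) :=
  exponents_eq he (Subgroup.subset_closure (by simp))

theorem exponents_b (he : ¬ IsInvertibleSymmetric e) :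
    exponents he ⟨b e, b_mem_group e⟩ = .ofAdd (0, 1) :=
  exponents_eq he (Subgroup.subset_closure (by simp))

theorem bSection_mem_group (e : Fin 3 → ZMod 4) (x : ZMod 4) : bSection e x ∈ group e := by
  rw [bSection]
  split_ifs
  exacts [b_mem_group e, shift_mem (a_mem_group e) _]

/-- These are the section families of the conjugates of `b` by powers of `a`. -/
theorem bSection_translate_mem_sectionGroup (e : Fin 3 → ZMod 4) (i : ZMod 4) :
    (fun x => (⟨bSection e (x - i), bSection_mem_group e _⟩ : group e)) ∈ sectionGroup e := by
  have h := shift_mul_diag i (bSection e)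
  rw [diag_bSection] at h
  change diag (fun x => bSection e (x - i)) ∈ group e
  rw [← mul_inv_eq_iff_eq_mul.2 h]
  exact mul_mem (mul_mem (shift_mem (a_mem_group e) i) (b_mem_group e))
    (inv_mem (shift_mem (a_mem_group e) i))

theorem exponents_bSection (he : ¬ IsInvertibleSymmetric e) (x : ZMod 4) :
    (exponents he ⟨bSection e x, bSection_mem_group e x⟩).toAdd.2 =
      (Pi.single 3 1 : ZMod 4 → ZMod 4) x := by
  by_cases hx : x = 3
  · subst hx
    exact congrArg (fun p => p.toAdd.2) (exponents_b he)
  · have h : (⟨bSection e x, bSection_mem_group e x⟩ : group e) =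
        ⟨a, a_mem_group e⟩ ^ (sectionExponent e x).val := by
      refine Subtype.ext ?_
      change bSection e x = a ^ (sectionExponent e x).val
      rw [a_pow_val, bSection, if_neg hx]
    rw [h, map_pow, exponents_a, ← ofAdd_nsmul]
    simp [hx]

/-- The exponents of `b` in a family of elements of the group. -/
def bExponents (he : ¬ IsInvertibleSymmetric e) :
    (ZMod 4 → group e) →* Multiplicative (ZMod 4 → ZMod 4) where
  toFun f := .ofAdd fun x => (exponents he (f x)).toAdd.2
  map_one' := by simp; rfl
  map_mul' f g := by simp; rfl

/-- The exponents of `a` in a family of elements of the group. -/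
def aExponents (he : ¬ IsInvertibleSymmetric e) :
    (ZMod 4 → group e) →* Multiplicative (ZMod 4 → ZMod 4) where
  toFun f := .ofAdd fun x => (exponents he (f x)).toAdd.1
  map_one' := by simp; rfl
  map_mul' f g := by simp; rfl

theorem aExponents_eq_circulant (he : ¬ IsInvertibleSymmetric e) {f : ZMod 4 → group e}
    (hf : f ∈ sectionGroup e) :
    (aExponents he f).toAdd = circulant e (bExponents he f).toAdd :=
  exponents_of_mem_sectionGroup he hf

/-- The conjugates of `b` by powers of `a` have the unit vectors as their families of `b`-exponents.
-/
theorem exists_mem_sectionGroup (he : ¬ IsInvertibleSymmetric e) (r : ZMod 4 → ZMod 4) :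
    ∃ f ∈ sectionGroup e, bExponents he f = .ofAdd r := by
  let T : AddSubgroup (ZMod 4 → ZMod 4) :=
    AddSubgroup.toSubgroup.symm ((sectionGroup e).map (bExponents he))
  have hT : r ∈ T := by
    refine AddSubgroup.pi_mem_of_single_mem r fun i => ?_
    have h1 : (Pi.single i 1 : ZMod 4 → ZMod 4) ∈ T := by
      refine ⟨_, bSection_translate_mem_sectionGroup e (i - 3), ?_⟩
      refine congrArg Multiplicative.ofAdd (funext fun x => ?_)
      change (exponents he ⟨bSection e (x - (i - 3)), bSection_mem_group e _⟩).toAdd.2 = _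
      rw [exponents_bSection]
      by_cases hx : x = i
      · subst hx
        simp
      · have : x - (i - 3) ≠ 3 := fun h => hx (by linear_combination h)
        simp [hx, this]
    have := nsmul_mem h1 (r i).val
    rwa [← Pi.single_smul, nsmul_one, ZMod.natCast_zmod_val] at this
  exact hT

/-- A section fixes the first level exactly when its `a`-exponent vanishes, and the families of
`a`-exponents that occur form the image of the circulant. -/
theorem relIndex_St_two_group (he : ¬ IsInvertibleSymmetric e) :
    (St 4 2).relIndex (group e) = 4 * Nat.card (circulant e).range := by
  have hker : stabilizerPower e 1 = (aExponents he).ker := by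
    ext f
    rw [MonoidHom.mem_ker]
    constructor
    · intro h
      exact congrArg Multiplicative.ofAdd
        (funext fun x => (exponents_fst_eq_zero_iff he (f x)).2 (h x trivial))
    · intro h x _
      exact (exponents_fst_eq_zero_iff he (f x)).1 (congrFun (congrArg Multiplicative.toAdd h) x)
  have hmap : (sectionGroup e).map (aExponents he) = AddSubgroup.toSubgroup (circulant e).range := by
    ext v
    constructor
    · rintro ⟨f, hf, rfl⟩
      exact ⟨_, (aExponents_eq_circulant he hf).symm⟩
    · rintro ⟨r, hr⟩
      obtain ⟨f, hf, hfr⟩ := exists_mem_sectionGroup he r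
      refine ⟨f, hf, ?_⟩
      have := aExponents_eq_circulant he hf
      rw [hfr] at this
      exact this.trans hr
  rw [relIndex_St_succ_group he, hker, Subgroup.relIndex_ker, hmap]
  rfl

/-! ### The index of the section group and the recursion for the orders -/

theorem exists_lowerCentralSeries_le (e : Fin 3 → ZMod 4) (n : ℕ) :
    ∃ k, (⊤ : Subgroup (group e)).lowerCentralSeries k ≤ (St 4 n).subgroupOf (group e) := by
  set S := (St 4 n).subgroupOf (group e) with hS
  have hp : IsPGroup 2 (group e ⧸ S) := by
    intro q
    obtain ⟨g, rfl⟩ := QuotientGroup.mk_surjective q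
    -- The quotient has exponent dividing 4ⁿ = 2²ⁿ; being a finite 2-group, it is nilpotent.
    refine ⟨2 * n, (QuotientGroup.eq_one_iff (g ^ 2 ^ (2 * n))).2 ?_⟩
    rw [pow_mul]
    exact pow_four_pow_mem_St (group_le_W4 e g.2) n
  have : Fact (Nat.Prime 2) := ⟨Nat.prime_two⟩
  have hfin : Finite (group e ⧸ S) := inferInstance
  obtain ⟨k, hk⟩ := Subgroup.nilpotent_iff_lowerCentralSeries.1 hp.isNilpotent
  refine ⟨k, ?_⟩
  have h := Subgroup.map_lowerCentralSeries ⊤ (QuotientGroup.mk' S) k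
  rwa [Subgroup.map_top_of_surjective _ (QuotientGroup.mk'_surjective S), hk,
    Subgroup.map_eq_bot_iff, QuotientGroup.ker_mk'] at h

theorem pi_lowerCentralSeries_one_le_sectionGroup_sup (he : ¬ IsInvertibleSymmetric e) (n : ℕ) :
    Subgroup.pi Set.univ (fun _ : ZMod 4 => (⊤ : Subgroup (group e)).lowerCentralSeries 1) ≤
      sectionGroup e ⊔ stabilizerPower e n := by
  obtain ⟨k, hk⟩ := exists_lowerCentralSeries_le e n
  have hb : (⟨bSection e 3, bSection_mem_group e 3⟩ : group e) = ⟨b e, b_mem_group e⟩ := rfl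
  have hf : ∀ x ≠ 3, (⟨bSection e x, bSection_mem_group e x⟩ : group e) =
      ⟨a, a_mem_group e⟩ ^ (((sectionExponent e x).val : ℕ) : ℤ) := by
    intro x hx
    rw [zpow_natCast]
    refine Subtype.ext ?_
    change bSection e x = a ^ (sectionExponent e x).val
    rw [a_pow_val, bSection, if_neg hx]
  have hpar : Odd (((sectionExponent e 0).val : ℕ) : ℤ) ∧
      Even (((sectionExponent e 2).val : ℕ) : ℤ) ∨ Even (((sectionExponent e 0).val : ℕ) : ℤ) ∧
      Odd (((sectionExponent e 2).val : ℕ) : ℤ) := by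
    have := val_parity_of_not_isInvertibleSymmetric he
    simp only [Int.odd_coe_nat, Int.even_coe_nat]
    exact this
  have ha : (⟨a, a_mem_group e⟩ : group e) ^ 4 = 1 := Subtype.ext a_pow_four
  refine (Subgroup.pi_lowerCentralSeries_one_le_sup
    (map_evalMonoidHom_eq_top (closure_generators e) ha hb hf
      (bSection_translate_mem_sectionGroup e) (hpar.imp And.left And.right))
    (pi_lowerCentralSeries_one_le (closure_generators e) ha hb hf
      (bSection_translate_mem_sectionGroup e) hpar) k).trans (sup_le_sup_left ?_ _)
  exact fun f hf x hx => hk (Subgroup.lowerCentralSeries_antitone _ k.le_succ (hf x hx))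

/-- The circulant relation between exponents cuts out exactly this subgroup; `n ≥ 2` is what makes
the exponents vanish on the stabilizers. -/
theorem index_sectionGroup_sup (he : ¬ IsInvertibleSymmetric e) {n : ℕ} (hn : 2 ≤ n) :
    (sectionGroup e ⊔ stabilizerPower e n).index = 4 ^ 4 := by
  let δ : (ZMod 4 → group e) →* Multiplicative (ZMod 4 → ZMod 4) :=
    aExponents he / (AddMonoidHom.toMultiplicative (circulant e)).comp (bExponents he)
  have hδ (f : ZMod 4 → group e) :
      δ f = 1 ↔ (aExponents he f).toAdd = circulant e (bExponents he f).toAdd := by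
    change aExponents he f / _ = 1 ↔ _
    rw [div_eq_one]
    rfl
  have hker : sectionGroup e ⊔ stabilizerPower e n = δ.ker := by
    refine le_antisymm (sup_le (fun f hf => ?_) fun f hf => ?_) fun f hf => ?_
    · exact (hδ f).2 (aExponents_eq_circulant he hf)
    · have h (x : ZMod 4) : exponents he (f x) = 1 :=
        exponents_eq_one_of_mem_St he hn (hf x trivial)
      refine (hδ f).2 ?_
      change (fun x => (exponents he (f x)).toAdd.1) =
        circulant e fun x => (exponents he (f x)).toAdd.2
      simp only [h]
      exact ((circulant e).map_zero).symm
    -- Matching the `b`-exponents by some `g` in the section group also matches the `a`-exponents,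
    -- so `g` and `f` differ by an element of (G')⁴.
    · obtain ⟨g, hg, hgf⟩ := exists_mem_sectionGroup he (bExponents he f).toAdd
      rw [← mul_inv_cancel_left g f]
      refine mul_mem (Subgroup.mem_sup_left hg)
        (pi_lowerCentralSeries_one_le_sectionGroup_sup he n fun x _ => ?_)
      refine ker_le_lowerCentralSeries_one (closure_generators e) (Subtype.ext a_pow_four)
        (Subtype.ext (b_pow_four e)) (exponents_a he) (exponents_b he) ?_
      have h1 : (bExponents he f).toAdd = (bExponents he g).toAdd := hgf.symm
      have h2 : (aExponents he f).toAdd = (aExponents he g).toAdd := by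
        rw [(hδ f).1 hf, aExponents_eq_circulant he hg, h1]
      have h3 : exponents he (f x) = exponents he (g x) :=
        Prod.ext (congrFun h2 x) (congrFun h1 x)
      change exponents he ((g x)⁻¹ * f x) = 1
      rw [map_mul, map_inv, h3, inv_mul_cancel]
  have hsurj : Function.Surjective δ := by
    intro v
    -- Powers of `a` have zero `b`-exponent, so on these families `δ` is just the vector of
    -- `a`-exponents.
    refine ⟨fun x => ⟨shift (v.toAdd x), shift_mem (a_mem_group e) _⟩, ?_⟩
    have h (t : ZMod 4) : exponents he ⟨shift t, shift_mem (a_mem_group e) t⟩ =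
        .ofAdd (t, 0) := by
      have h1 : (⟨shift t, shift_mem (a_mem_group e) t⟩ : group e) =
        ⟨a, a_mem_group e⟩ ^ t.val := Subtype.ext (a_pow_val t).symm
      rw [h1, map_pow, exponents_a, ← ofAdd_nsmul]
      simp
    change aExponents he _ / Multiplicative.ofAdd (circulant e fun x =>
      (exponents he ⟨shift (v.toAdd x), shift_mem (a_mem_group e) _⟩).toAdd.2) = v
    simp only [h]
    have h0 : circulant e (fun x => (Multiplicative.ofAdd (v.toAdd x, (0 : ZMod 4))).toAdd.2) = 0 :=
      (circulant e).map_zero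
    rw [h0, ofAdd_zero, div_one]
    change Multiplicative.ofAdd (fun x =>
      (exponents he ⟨shift (v.toAdd x), shift_mem (a_mem_group e) _⟩).toAdd.1) = v
    simp only [h]
    rfl
  rw [hker, Subgroup.index_ker, MonoidHom.range_eq_top.2 hsurj, Subgroup.card_top,
    Nat.card_congr Multiplicative.toAdd, Nat.card_fun, Nat.card_zmod]

theorem relIndex_St_succ_group_mul (he : ¬ IsInvertibleSymmetric e) {n : ℕ} (hn : 2 ≤ n) :
    4 ^ 3 * (St 4 (n + 1)).relIndex (group e) = (St 4 n).relIndex (group e) ^ 4 := by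
  have h := Subgroup.relIndex_mul_index
    (le_sup_right : stabilizerPower e n ≤ sectionGroup e ⊔ stabilizerPower e n)
  rw [Subgroup.relIndex_sup_right, index_sectionGroup_sup he hn, index_stabilizerPower] at h
  rw [relIndex_St_succ_group he, ← h]
  ring

/-- The logarithms satisfy E ↦ 4E − 3, whose fixed point is 1; the excess over 1 starts at `c` on
level 2 and is multiplied by 4 at each level. -/
theorem relIndex_St_group (he : ¬ IsInvertibleSymmetric e) {c : ℕ}
    (hc : Nat.card (circulant e).range = 4 ^ c) (n : ℕ) :
    (St 4 (n + 2)).relIndex (group e) = 4 ^ (c * 4 ^ n + 1) := by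
  induction n with
  | zero => rw [zero_add, relIndex_St_two_group he, hc]; ring
  | succ n ih =>
    refine Nat.eq_of_mul_eq_mul_left (show 0 < 4 ^ 3 by norm_num) ?_
    rw [show n + 1 + 2 = n + 2 + 1 by ring, relIndex_St_succ_group_mul he (by omega), ih]
    ring

/-! ### Logarithmic orders and the Hausdorff dimension -/

theorem logOrder_group (he : ¬ IsInvertibleSymmetric e) {c : ℕ}
    (hc : Nat.card (circulant e).range = 4 ^ c) (n : ℕ) :
    logOrder (group e) (n + 2) = c * 4 ^ n + 1 := by
  rw [logOrder_eq, relIndex_St_group he hc, Nat.cast_pow, Real.logb_pow, Real.logb_self_eq_one]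
  · push_cast; ring
  · norm_num

theorem logOrder_W4 (n : ℕ) : logOrder W4 n = (4 ^ n - 1) / 3 := by
  have h := geom_sum_eq (show (4 : ℝ) ≠ 1 by norm_num) n
  rw [logOrder_eq, relIndex_St_W4, Nat.cast_pow, Real.logb_pow, Real.logb_self_eq_one]
  · push_cast
    rw [h]
    norm_num
  · norm_num

theorem hdim_group (he : ¬ IsInvertibleSymmetric e) {c : ℕ}
    (hc : Nat.card (circulant e).range = 4 ^ c) :
    hdim W4 (group e).topologicalClosure = 3 * c / 16 := by
  refine Tendsto.liminf_eq ?_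
  rw [← tendsto_add_atTop_iff_nat 2]
  have h0 : Tendsto (fun n : ℕ => ((1 / 4 : ℝ)) ^ n) atTop (nhds 0) :=
    tendsto_pow_atTop_nhds_zero_of_lt_one (by norm_num) (by norm_num)
  -- This is the ratio (c·4ⁿ + 1) / ((4ⁿ⁺² − 1)/3) at level `n + 2`, with numerator and denominator
  -- divided by 4ⁿ. It converges, so the lower limit is a limit.
  have h1 : Tendsto (fun n : ℕ => 3 * (c + (1 / 4 : ℝ) ^ n) / (16 - (1 / 4 : ℝ) ^ n)) atTop
      (nhds (3 * (c + 0) / (16 - 0))) :=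
    ((h0.const_add _).const_mul _).div (h0.const_sub _) (by norm_num)
  rw [add_zero, sub_zero] at h1
  refine h1.congr fun n => ?_
  rw [logOrder_topologicalClosure, logOrder_group he hc, logOrder_W4, one_div, inv_pow]
  have h4 : (1 : ℝ) ≤ 4 ^ n := one_le_pow₀ (by norm_num)
  have h5 : (4 : ℝ) ^ (n + 2) - 1 ≠ 0 := by rw [pow_add]; linarith
  have h6 : (16 : ℝ) - (4 ^ n)⁻¹ ≠ 0 := by
    have := inv_le_one_of_one_le₀ h4
    linarith
  rw [div_eq_div_iff h6 (div_ne_zero h5 (by norm_num)), pow_add]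
  field_simp
  ring

end GGS

end

theorem theorem2 (e : Fin 3 → ZMod 4) (he : ¬ GGS.IsInvertibleSymmetric e) :
    (Odd (e 0 + e 1 + e 2) →
      AutT.hdim GGS.W4 (GGS.group e).topologicalClosure = 3 / 4 ∧
      AutT.logOrder (GGS.group e) 1 = 1 ∧
      ∀ n : ℕ, 2 ≤ n → AutT.logOrder (GGS.group e) n = 4 ^ (n - 1) + 1) ∧
    (¬ Odd (e 0 + e 1 + e 2) →
      AutT.hdim GGS.W4 (GGS.group e).topologicalClosure = 9 / 16 ∧
      ∀ n : ℕ, 2 ≤ n → AutT.logOrder (GGS.group e) n = 3 * 4 ^ (n - 2) + 1) := by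
  refine ⟨fun h => ?_, fun h => ?_⟩
  · have hc := GGS.card_range_circulant_of_odd he h
    refine ⟨(GGS.hdim_group he hc).trans (by norm_num), ?_, fun n hn => ?_⟩
    · rw [AutT.logOrder_eq, GGS.relIndex_St_one (GGS.group_le_W4 e) (GGS.a_mem_group e)]
      exact Real.logb_self_eq_one (by norm_num)
    · obtain ⟨n, rfl⟩ := Nat.exists_eq_add_of_le' hn
      rw [GGS.logOrder_group he hc, show n + 2 - 1 = n + 1 by omega, pow_succ']
      norm_num
  · have hc := GGS.card_range_circulant_of_not_odd he h
    refine ⟨(GGS.hdim_group he hc).trans (by norm_num), fun n hn => ?_⟩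
    obtain ⟨n, rfl⟩ := Nat.exists_eq_add_of_le' hn
    rw [GGS.logOrder_group he hc, Nat.add_sub_cancel]
    norm_num
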